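/- Let $p\ge 0$ and let $\mathcal F$ be a $C^1$ foliation of codimension $2$, with $p$-dimensional leaves, on a manifold $M$ (Hausdorff, second countable; if $M$ has boundary, then $\partial M$ is a union of leaves). Compactness of a leaf is meant in its leaf topology. A transverse $2$-manifold is a $C^1$ submanifold $T\subset M$ of dimension $2$, possibly with boundary $\partial T$, which is transverse to $\mathcal F$ and whose closure lies in the interior $S\setminus\partial S$ of some $2$-dimensional $C^1$ submanifold $S$ of $M$ transverse to $\mathcal F$. Let $T$ be a transverse $2$-manifold which is a closed subset of $M$ (for instance, a compact one), let $C\subset T$ be compact and connected, let $W$ be the union of all leaves through points of $C$, and let $E\subset C$ be the set of points of $C$ lying in a non-compact leaf. Assume that (i) no compact leaf of $W$ intersects $\partial T$; (ii) every non-compact leaf of $W$ intersects $T\setminus\partial T$ in infinitely many points; (iii) for every compact leaf $L$, every point $x\in C\cap L$ and every loop $\omega$ in $L$ based at $x$, a representative of the holonomy map of $\omega$, defined in a neighbourhood of $x$ in $T$, preserves the local orientation at $x$; (iv) $E$ is a countable (possibly finite or empty) union of pairwise disjoint closed sets. Then either all leaves of $W$ are non-compact, or there exists an integer $\rho$ such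 that all but finitely many leaves of $W$ intersect $T$ in exactly $\rho$ points, and the finitely many other leaves of $W$ intersect $T$ in fewer than $\rho$ points. -/

import Mathlib

open scoped Manifold Topology unitInterval

namespace Foliation

/-- The local model of a codimension-2 foliation with `p`-dimensional leaves: points `(x, y)` with
`x ∈ ℝᵖ` the coordinate along the leaves and `y` the transverse coordinate in a closed half plane.
The half plane allows manifolds with boundary whose boundary is a union of leaves; charts that
avoid the edge of the half plane are ordinary interior charts. -/
abbrev Model (p : ℕ) : Type :=
  ModelProd (EuclideanSpace ℝ (Fin p)) (EuclideanHalfSpace 2)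

/-- The model with corners of `Model p`, with tangent space `ℝᵖ × ℝ²`. -/
noncomputable abbrev corners (p : ℕ) :
    ModelWithCorners ℝ (EuclideanSpace ℝ (Fin p) × EuclideanSpace ℝ (Fin 2)) (Model p) :=
  (𝓡 p).prod (𝓡∂ 2)

/-- The atlas of `M` is a `C¹` foliated atlas of codimension 2: the coordinate changes are `C¹`
and locally of the form `(x, y) ↦ (f (x, y), g y)`. -/
class IsFoliated (p : ℕ) (M : Type*) [TopologicalSpace M] [ChartedSpace (Model p) M] : Prop
    extends IsManifold (corners p) 1 M where
  transverse_coord : ∀ e ∈ atlas (Model p) M, ∀ e' ∈ atlas (Model p) M,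
    ∀ z ∈ (e.symm.trans e').source, ∃ N ∈ 𝓝 z, ∀ z₁ ∈ N, ∀ z₂ ∈ N,
      z₁.2 = z₂.2 → (e' (e.symm z₁)).2 = (e' (e.symm z₂)).2

section

variable (p : ℕ) {M : Type*} [TopologicalSpace M] [ChartedSpace (Model p) M]

/-- The leaf topology, generated by the relatively open subsets of the level sets of the
transverse coordinate in the foliated charts. -/
@[reducible] def leafTopology (M : Type*) [TopologicalSpace M] [ChartedSpace (Model p) M] :
    TopologicalSpace M :=
  TopologicalSpace.generateFrom
    {P | ∃ e ∈ atlas (Model p) M, ∃ V : Set M, IsOpen V ∧ ∃ y : EuclideanHalfSpace 2,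
      P = {m | m ∈ e.source ∧ m ∈ V ∧ (e m).2 = y}}

/-- The leaf through `m`: the connected component of `m` in the leaf topology. -/
def leaf (m : M) : Set M :=
  @connectedComponent M (leafTopology p M) m

/-- Compactness of a leaf, as a manifold in its own right (that is, in the leaf topology). -/
def IsCompactLeaf (L : Set M) : Prop :=
  @IsCompact M (leafTopology p M) L

/-- The tangent space of the leaf through `m`. Tangent vectors at `m` are written in the preferred
chart at `m`, which is foliated, so these are the vectors with transverse component zero. -/
noncomputable def leafTangent (m : M) : Submodule ℝ (TangentSpace (corners p) m) :=
  LinearMap.ker (LinearMap.snd ℝ (EuclideanSpace ℝ (Fin p)) (EuclideanSpace ℝ (Fin 2)))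

/-- `T`, with its subspace topology and the given charts, is a `C¹` surface, possibly with
boundary, whose inclusion in `M` is `C¹`, and at each point the tangent space of `M` is the direct
sum of that of `T` and that of the leaf. (So the inclusion is an immersion.) -/
def IsTransverseSurface (T : Set M) [ChartedSpace (EuclideanHalfSpace 2) T] : Prop :=
  IsManifold (𝓡∂ 2) 1 T ∧
  ContMDiff (𝓡∂ 2) (corners p) 1 (Subtype.val : T → M) ∧
  ∀ t : T, IsCompl
    (LinearMap.range (mfderiv (𝓡∂ 2) (corners p) (Subtype.val : T → M) t).toLinearMap)
    (leafTangent p (t : M))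

/-- The boundary points of `T` (in the sense of manifolds), as a subset of `M`. -/
def bdry (T : Set M) [ChartedSpace (EuclideanHalfSpace 2) T] : Set M :=
  Subtype.val '' ((𝓡∂ 2).boundary T)

/-- The interior points of `T` (in the sense of manifolds), as a subset of `M`. -/
def inner (T : Set M) [ChartedSpace (EuclideanHalfSpace 2) T] : Set M :=
  Subtype.val '' ((𝓡∂ 2).interior T)

/-- A transverse 2-manifold: a transverse surface whose closure lies in the interior of some
transverse surface. -/
def IsTransverseManifold (T : Set M) [ChartedSpace (EuclideanHalfSpace 2) T] : Prop :=
  IsTransverseSurface p T ∧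
  ∃ (S : Set M) (_ : ChartedSpace (EuclideanHalfSpace 2) S),
    IsTransverseSurface p S ∧ closure T ⊆ inner S

/-- `ω` is a loop based at `m` in the leaf through `m`. -/
def IsLeafLoop (m : M) (ω : I → M) : Prop :=
  @Continuous I M _ (leafTopology p M) ω ∧ ω 0 = m ∧ ω 1 = m

/-- `h`, restricted to a small neighbourhood of `x` in `T`, represents the holonomy along the leaf
loop `ω` based at `x`: the points `y` of `T` near `x` can be moved inside their leaves, by paths
depending continuously on `y` and extending `ω`, from `y` to `h y`. -/
def IsHolonomy (T : Set M) (x : T) (ω : I → M) (h : T → T) : Prop :=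
  ∃ N ∈ 𝓝 x, ∃ H : T × I → M, ContinuousOn H (N ×ˢ Set.univ) ∧
    (∀ y ∈ N, @Continuous I M _ (leafTopology p M) (fun s => H (y, s))) ∧
    (∀ y ∈ N, H (y, 0) = (y : M) ∧ H (y, 1) = (h y : M)) ∧
    ∀ s, H (x, s) = ω s

/-- The `C¹` map `h` with fixed point `x` preserves the local orientation of `T` at `x`: its
differential at `x` (in the preferred chart at `x`) has positive determinant. -/
def PreservesOrientationAt (T : Set M) [ChartedSpace (EuclideanHalfSpace 2) T]
    (h : T → T) (x : T) : Prop :=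
  h x = x ∧ MDifferentiableAt (𝓡∂ 2) (𝓡∂ 2) h x ∧
    0 < LinearMap.det (M := EuclideanSpace ℝ (Fin 2))
      (mfderiv (𝓡∂ 2) (𝓡∂ 2) h x).toLinearMap

end

end Foliation

/-! For `x ∈ C` let `n x` be the number of points in which the leaf of `x` meets `T`. By (i), (ii)
and the closedness of `T`, `n x` is infinite exactly when this leaf is non-compact. Moreover `n` is
lower semicontinuous, because finitely many intersections with the interior of `T` persist on nearby
leaves (`eventually_lt_encard`).

The local heart is `exists_eventually_encard_eq`: if the leaf of `x` is compact, then for each `m`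
all `y ≠ x` near `x` with `n y ≤ m` share one value of `n`. Such `y` are periodic under every return
germ of `T`, with a period dividing `m!`. For a planar `C¹` germ with positive determinant at the
fixed point `x`, fixed points and moved points of bounded period cannot both accumulate at `x`: the
former force the eigenvalue 1, the latter then a second eigenvalue that is not positive
(`eventually_fixed_or_eventually_not_fixed`). Hence two holonomy germs into `T` either agree or
differ at all these `y`. Finitely many germs represent all of them, and by compactness the leaf of
`y` stays near that of `x` and meets `T` exactly in the values of these germs at `y`.

Globally, the sets `Q k` of points of finite `n` with nearby value `k` are closed and disjoint, and
together with the sets of (iv) they cover the continuum `C`. By Sierpiński's theorem one set is all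
of `C`. If it is one of the sets of (iv), every leaf is non-compact; if it is `Q ρ`, then `n ≤ ρ`,
with equality off a set without accumulation points, which is finite. -/

namespace Foliation

open Filter Set

/-! ### Continua, Sierpiński's theorem and semicontinuous counting functions -/

section Continua

variable {X : Type*} [TopologicalSpace X] [CompactSpace X] [T2Space X]

/-- Boundary bumping: the part of a continuum inside the closure of an open set `U` contains a
subcontinuum through a given point that reaches the frontier of `U`. -/
theorem exists_subcontinuum_not_subset {K U : Set X} (hK : IsClosed K) (hKc : IsPreconnected K)
    (hU : IsOpen U) {x : X} (hxK : x ∈ K) (hxU : x ∈ U) (hKU : ¬ K ⊆ U) :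
    ∃ K' ⊆ K, IsClosed K' ∧ IsPreconnected K' ∧ x ∈ K' ∧ ¬ K' ⊆ U ∧ K' ⊆ closure U := by
  set F : Set X := K ∩ closure U with hF
  have hFc : IsClosed F := hK.inter isClosed_closure
  have : CompactSpace F := isCompact_iff_compactSpace.mp hFc.isCompact
  let x' : F := ⟨x, hxK, subset_closure hxU⟩
  refine ⟨Subtype.val '' connectedComponent x', ?_, ?_, ?_, ⟨x', mem_connectedComponent, rfl⟩, ?_, ?_⟩
  · rintro _ ⟨y, -, rfl⟩; exact y.2.1
  · exact hFc.isClosedEmbedding_subtypeVal.isClosedMap _ isClosed_connectedComponent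
  · exact isPreconnected_connectedComponent.image _ continuous_subtype_val.continuousOn
  -- The component is the intersection of its clopen neighbourhoods, so some clopen `Z` already lies
  -- in `U`. Then `Z = K ∩ O ∩ U` is clopen in `K` as well, against the connectedness of `K`.
  · intro hsub
    have hopen : IsOpen (Subtype.val ⁻¹' U : Set F) := hU.preimage continuous_subtype_val
    have hcomp : (⋂ s : { s : Set F // IsClopen s ∧ x' ∈ s }, (s : Set F)) ⊆ Subtype.val ⁻¹' U := by
      rw [← connectedComponent_eq_iInter_isClopen]
      exact fun y hy => hsub ⟨y, hy, rfl⟩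
    have : Nonempty { s : Set F // IsClopen s ∧ x' ∈ s } := ⟨⟨univ, isClopen_univ, mem_univ _⟩⟩
    obtain ⟨⟨Z, hZ, hxZ⟩, hZU⟩ := exists_subset_nhds_of_isCompact'
      (V := fun s : { s : Set F // IsClopen s ∧ x' ∈ s } => (s : Set F))
      (fun s t => ⟨⟨s.1 ∩ t.1, s.2.1.inter t.2.1, s.2.2, t.2.2⟩, inter_subset_left,
        inter_subset_right⟩)
      (fun s => s.2.1.isClosed.isCompact) (fun s => s.2.1.isClosed)
      (U := Subtype.val ⁻¹' U) (fun y hy => hopen.mem_nhds (hcomp hy))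
    obtain ⟨O, hO, hOZ⟩ := isOpen_induced_iff.mp hZ.isOpen
    have hZc : IsClosed (Subtype.val '' Z) :=
      hFc.isClosedEmbedding_subtypeVal.isClosedMap _ hZ.isClosed
    have hmemZ : ∀ y, y ∈ Subtype.val '' Z ↔ y ∈ K ∧ y ∈ O ∧ y ∈ U := by
      intro y
      constructor
      · rintro ⟨w, hw, rfl⟩
        refine ⟨w.2.1, ?_, hZU hw⟩
        rw [← hOZ] at hw; exact hw
      · rintro ⟨h1, h2, h3⟩
        refine ⟨⟨y, h1, subset_closure h3⟩, ?_, rfl⟩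
        rw [← hOZ]; exact h2
    have := isPreconnected_closed_iff.mp hKc (Subtype.val '' Z) (O ∩ U)ᶜ hZc
      (hO.inter hU).isClosed_compl ?_ ⟨x, hxK, ⟨x', hxZ, rfl⟩⟩ ?_
    · obtain ⟨y, -, hy, hy'⟩ := this
      exact hy' ((hmemZ y).mp hy).2
    · intro y hy
      by_cases h : y ∈ O ∩ U
      · exact Or.inl ((hmemZ y).mpr ⟨hy, h⟩)
      · exact Or.inr h
    · obtain ⟨y, hy, hyU⟩ := not_subset.mp hKU
      exact ⟨y, hy, fun h => hyU h.2⟩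
  · rintro _ ⟨y, -, rfl⟩; exact y.2.2

/-- Boundary bumping is applied in a neighbourhood `u` of another member `A j` whose closure misses
`A i`. The new continuum meets `A j`, so `A j` is the only member that could contain it; but it
leaves `u`. -/
theorem exists_subcontinuum_disjoint {ι : Type*} {A : ι → Set X} (hA : ∀ i, IsClosed (A i))
    (hdisj : Pairwise fun i j => Disjoint (A i) (A j)) (hcov : ∀ x, ∃ i, x ∈ A i)
    {K : Set X} (hK : IsClosed K) (hKc : IsPreconnected K) (hKA : ∀ i, ¬ K ⊆ A i) (i : ι) :
    ∃ K' ⊆ K, IsClosed K' ∧ IsPreconnected K' ∧ (∀ j, ¬ K' ⊆ A j) ∧ Disjoint K' (A i) := by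
  by_cases hi : Disjoint K (A i)
  · exact ⟨K, Subset.rfl, hK, hKc, hKA, hi⟩
  obtain ⟨x, hxK, hxi⟩ := not_subset.mp (hKA i)
  obtain ⟨j, hj⟩ := hcov x
  have hij : j ≠ i := by rintro rfl; exact hxi hj
  obtain ⟨u, hu, hAu, hui⟩ := normal_exists_closure_subset (hA j) (hA i).isOpen_compl
    (fun y hy hy' => (hdisj hij).le_bot ⟨hy, hy'⟩)
  have hKu : ¬ K ⊆ u := fun h => hi <| Set.disjoint_left.mpr fun y hy =>
    hui (subset_closure (h hy))
  obtain ⟨K', hK', h1, h2, h3, h4, h5⟩ :=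
    exists_subcontinuum_not_subset hK hKc hu hxK (hAu hj) hKu
  refine ⟨K', hK', h1, h2, fun l hl => ?_, Set.disjoint_left.mpr fun y hy => hui (h5 hy)⟩
  have : l = j := by
    by_contra hlj
    exact (hdisj hlj).le_bot ⟨hl h3, hj⟩
  subst this
  exact h4 (hl.trans hAu)

/-- Sierpiński's theorem: a continuum is not a countable disjoint union of at least two
nonempty closed sets. -/
theorem exists_eq_univ_of_disjoint_closed_cover [PreconnectedSpace X] {A : ℕ → Set X}
    (hA : ∀ i, IsClosed (A i)) (hdisj : Pairwise fun i j => Disjoint (A i) (A j))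
    (hcov : ∀ x, ∃ i, x ∈ A i) : ∃ i, A i = univ := by
  by_contra hne
  push Not at hne
  let S := { K : Set X // IsClosed K ∧ IsPreconnected K ∧ ∀ j, ¬ K ⊆ A j }
  have step : ∀ (i : ℕ) (K : S), ∃ K' : S, K'.1 ⊆ K.1 ∧ Disjoint K'.1 (A i) := by
    rintro i ⟨K, h1, h2, h3⟩
    obtain ⟨K', h, h1', h2', h3', h4⟩ := exists_subcontinuum_disjoint hA hdisj hcov h1 h2 h3 i
    exact ⟨⟨K', h1', h2', h3'⟩, h, h4⟩
  choose next hsub hdis using step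
  let K0 : S := ⟨univ, isClosed_univ, isPreconnected_univ, fun j h => hne j (univ_subset_iff.mp h)⟩
  -- Stage `i + 1` avoids `A i`, so a point common to all stages lies in no member of the cover.
  let K : ℕ → S := fun n => Nat.rec K0 (fun i k => next i k) n
  have hKs : ∀ n, K (n + 1) = next n (K n) := fun n => rfl
  have hne' : (⋂ n, (K n).1).Nonempty := by
    refine IsCompact.nonempty_iInter_of_sequence_nonempty_isCompact_isClosed _ (fun n => ?_)
      (fun n => ?_) ((K 0).2.1.isCompact) (fun n => (K n).2.1)
    · rw [hKs]; exact hsub n (K n)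
    · by_contra h
      rw [not_nonempty_iff_eq_empty] at h
      exact (K n).2.2.2 0 (by rw [h]; exact empty_subset _)
  obtain ⟨x, hx⟩ := hne'
  obtain ⟨i, hi⟩ := hcov x
  have := mem_iInter.mp hx (i + 1)
  rw [hKs] at this
  exact (hdis i (K i)).le_bot ⟨this, hi⟩

/-- A lower semicontinuous counting function on a continuum that is constant on punctured
neighbourhoods within its sublevel sets is infinite everywhere or almost constant. -/
theorem eq_top_or_almost_constant [ConnectedSpace X] (n : X → ℕ∞)
    (hclosed : ∀ k : ℕ, IsClosed {x | n x ≤ k})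
    (hconst : ∀ x, n x ≠ ⊤ → ∀ m : ℕ, ∃ c : ℕ, ∀ᶠ y in 𝓝[≠] x, n y ≤ m → n y = c)
    (E : ℕ → Set X) (hE : ∀ i, IsClosed (E i)) (hEd : Pairwise fun i j => Disjoint (E i) (E j))
    (hEu : ⋃ i, E i = {x | n x = ⊤}) :
    (∀ x, n x = ⊤) ∨ ∃ ρ : ℕ, {x | n x ≠ ρ}.Finite ∧ ∀ x, n x ≠ ρ → n x < ρ := by
  -- Either `k` is a value of `n` at points arbitrarily near `x`, or `n` tends to infinity at `x`
  -- (vacuously if `x` is isolated) and `k` is the value at `x` itself.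
  let Q : ℕ → Set X := fun k => {x | n x ≠ ⊤ ∧ ∃ᶠ y in 𝓝[≠] x, n y = k} ∪
    {x | n x = k ∧ ∀ m : ℕ, ∀ᶠ y in 𝓝[≠] x, ¬ n y ≤ m}
  have hQle : ∀ k, ∀ x ∈ Q k, n x ≤ k := by
    rintro k x (⟨-, h⟩ | ⟨h, -⟩)
    · have : x ∈ closure {x | n x ≤ k} := by
        rw [mem_closure_iff_frequently]
        exact (h.filter_mono nhdsWithin_le_nhds).mono fun y hy => hy.le
      rwa [(hclosed k).closure_eq] at this
    · exact h.le
  have hQtop : ∀ k, ∀ x ∈ Q k, n x ≠ ⊤ := fun k x hx h => by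
    have := hQle k x hx
    rw [h] at this
    exact absurd this (by simp)
  have hQclosed : ∀ k, IsClosed (Q k) := by
    intro k
    rw [isClosed_iff_frequently]
    intro z hz
    by_contra hzQ
    have hzle : n z ≤ k := by
      have : z ∈ closure {x | n x ≤ k} := by
        rw [mem_closure_iff_frequently]
        exact hz.mono fun y hy => hQle k y hy
      rwa [(hclosed k).closure_eq] at this
    refine hzQ (Or.inl ⟨ne_top_of_le_ne_top (by simp) hzle, ?_⟩)
    have hz' : ∃ᶠ y in 𝓝[≠] z, y ∈ Q k := by
      rw [frequently_nhdsWithin_iff]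
      exact hz.mono fun y hy => ⟨hy, fun h => hzQ (h ▸ hy)⟩
    -- If `n ≠ k` on a punctured neighbourhood of `z`, then each of its points has a full
    -- neighbourhood where `n ≠ k`, which excludes both clauses of `Q k`.
    intro hev
    refine hz' ?_
    have hev' := eventually_nhdsWithin_iff.mp hev
    rw [eventually_nhdsWithin_iff]
    filter_upwards [hev'.eventually_nhds] with y hy hyz hyQ
    rcases hyQ with ⟨-, h⟩ | ⟨h, -⟩
    · refine (h.filter_mono nhdsWithin_le_nhds) ?_
      filter_upwards [hy, isOpen_compl_singleton.mem_nhds hyz] with w hw hwz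
      exact hw hwz
    · exact hy.self_of_nhds hyz h
  have hQdisj : ∀ k l, k ≠ l → Disjoint (Q k) (Q l) := by
    intro k l hkl
    rw [Set.disjoint_left]
    have key : ∀ (k l : ℕ) x, (∃ᶠ y in 𝓝[≠] x, n y = k) →
        ¬ (∀ m : ℕ, ∀ᶠ y in 𝓝[≠] x, ¬ n y ≤ m) := fun k l x h h' =>
      h ((h' k).mono fun y hy hy' => hy hy'.le)
    rintro x (⟨h0, h⟩ | ⟨h0, h⟩) (⟨h0', h'⟩ | ⟨h0', h'⟩)
    · obtain ⟨c, hc⟩ := hconst x h0 (max k l)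
      obtain ⟨y, hy, hy'⟩ := (h.and_eventually hc).exists
      obtain ⟨z, hz, hz'⟩ := (h'.and_eventually hc).exists
      have h1 := hy' (by rw [hy]; exact_mod_cast le_max_left _ _)
      have h2 := hz' (by rw [hz]; exact_mod_cast le_max_right _ _)
      rw [hy] at h1; rw [hz] at h2
      exact hkl (by exact_mod_cast h1.trans h2.symm)
    · exact key k l x h h'
    · exact key l k x h' h
    · rw [h0] at h0'; exact hkl (by exact_mod_cast h0')
  have hQcov : ∀ x, n x ≠ ⊤ → ∃ k, x ∈ Q k := by
    intro x hx
    by_cases h : ∀ m : ℕ, ∀ᶠ y in 𝓝[≠] x, ¬ n y ≤ m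
    · obtain ⟨k, hk⟩ := ENat.ne_top_iff_exists.mp hx
      exact ⟨k, Or.inr ⟨hk.symm, h⟩⟩
    · push Not at h
      obtain ⟨m, hm⟩ := h
      obtain ⟨c, hc⟩ := hconst x hx m
      refine ⟨c, Or.inl ⟨hx, ?_⟩⟩
      exact (hm.and_eventually hc).mono fun y hy => hy.2 hy.1
  have hQE : ∀ i k, Disjoint (E i) (Q k) := by
    intro i k
    rw [Set.disjoint_left]
    intro x hx hx'
    exact hQtop k x hx' (by have := mem_iUnion_of_mem i hx; rwa [hEu] at this)
  let e : ℕ ≃ ℕ ⊕ ℕ := Equiv.natSumNatEquivNat.symm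
  let B : ℕ ⊕ ℕ → Set X := Sum.elim E Q
  obtain ⟨i, hi⟩ := exists_eq_univ_of_disjoint_closed_cover (A := fun i => B (e i))
    (fun i => by
      rcases h : e i with j | j
      · simpa [B, h] using hE j
      · simpa [B, h] using hQclosed j)
    (by
      have : Pairwise fun i j => Disjoint (B i) (B j) := by
        rintro (i | i) (j | j) hij
        · exact hEd (by simpa using hij)
        · exact hQE i j
        · exact (hQE j i).symm
        · exact hQdisj i j (by simpa using hij)
      exact fun i j hij => this (e.injective.ne hij))
    (fun x => by
      by_cases hx : n x = ⊤
      · have : x ∈ ⋃ i, E i := by rw [hEu]; exact hx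
        obtain ⟨j, hj⟩ := mem_iUnion.mp this
        exact ⟨e.symm (Sum.inl j), by simpa [B] using hj⟩
      · obtain ⟨k, hk⟩ := hQcov x hx
        exact ⟨e.symm (Sum.inr k), by simpa [B] using hk⟩)
  rcases h : e i with j | k
  · left
    intro x
    have : x ∈ ⋃ i, E i := mem_iUnion_of_mem j (by
      have : E j = univ := by simpa [B, h] using hi
      rw [this]; trivial)
    rwa [hEu] at this
  · right
    have hk : ∀ x, x ∈ Q k := by
      have : Q k = univ := by
        change B (e i) = univ at hi
        rw [h] at hi
        exact hi
      intro x; rw [this]; trivial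
    have hev : ∀ x, ∀ᶠ y in 𝓝[≠] x, n y = k := by
      intro x
      obtain ⟨c, hc⟩ := hconst x (hQtop k x (hk x)) k
      have hc' : ∀ᶠ y in 𝓝[≠] x, n y = c := hc.mono fun y hy => hy (hQle k y (hk y))
      rcases hk x with ⟨-, h⟩ | ⟨-, h⟩
      · obtain ⟨y, hy, hy'⟩ := (h.and_eventually hc').exists
        rw [← hy, hy']; rw [hy'] at hy
        simpa [hy] using hc'
      -- Here `n ≤ k` everywhere contradicts growth to infinity unless `x` is isolated, so the claim
      -- is vacuous.
      · exact (h k).mono fun y hy => absurd (hQle k y (hk y)) hy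
    refine ⟨k, ?_, fun x hx => lt_of_le_of_ne (hQle k x (hk x)) hx⟩
    by_contra hinf
    obtain ⟨x, hx⟩ := Set.Infinite.exists_accPt_principal (s := {x | n x ≠ k}) hinf
    rw [accPt_iff_frequently_nhdsNE] at hx
    exact hx ((hev x).mono fun y hy h => h hy)

end Continua

/-! ### Periodic points of planar germs -/

section LinearAlgebra

variable {E : Type*} [NormedAddCommGroup E] [NormedSpace ℝ E] [FiniteDimensional ℝ E]

/-- In finite dimension an injective derivative is invertible, and the local left inverse of the
inverse function theorem separates points. -/
theorem _root_.HasStrictFDerivAt.eventually_injective {f : E → E} {A : E →L[ℝ] E} {x : E}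
    (hf : HasStrictFDerivAt f A x) (hA : Function.Injective A) :
    ∀ᶠ u in 𝓝 (x, x), f u.1 = f u.2 → u.1 = u.2 := by
  have := FiniteDimensional.complete ℝ E
  let A' : E ≃L[ℝ] E := (LinearEquiv.ofInjectiveEndo A.toLinearMap hA).toContinuousLinearEquiv
  have hf' : HasStrictFDerivAt f (A' : E →L[ℝ] E) x := by
    convert hf using 1
    ext v; rfl
  have h := hf'.eventually_left_inverse
  rw [nhds_prod_eq]
  filter_upwards [h.prod_mk h] with u hu huv
  rw [← hu.1, ← hu.2, huv]

omit [FiniteDimensional ℝ E] in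
/-- A plane endomorphism with a nonzero fixed vector and a nonzero vector whose orbit of length
`N` sums to zero reverses the orientation or is singular. -/
theorem det_nonpos_of_fixed_of_sum_eq_zero (hE : Module.finrank ℝ E = 2) (A : E →ₗ[ℝ] E) {v w : E}
    (hv : v ≠ 0) (hAv : A v = v) (hw : w ≠ 0) {N : ℕ} (hN : 0 < N)
    (hsum : ∑ j ∈ Finset.range N, (A ^ j) w = 0) : LinearMap.det A ≤ 0 := by
  have hpow : ∀ j : ℕ, (A ^ j) v = v := by
    intro j
    induction j with
    | zero => simp
    | succ j ih => rw [pow_succ, Module.End.mul_apply, hAv, ih]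
  have hli : LinearIndependent ℝ ![v, w] := by
    rw [LinearIndependent.pair_iff' hv]
    rintro a rfl
    simp only [map_smul, hpow] at hsum
    rw [Finset.sum_const, Finset.card_range] at hsum
    have : a ≠ 0 := fun h => hw (by simp [h])
    rw [← Nat.cast_smul_eq_nsmul ℝ] at hsum
    exact smul_ne_zero (Nat.cast_ne_zero.mpr hN.ne') (smul_ne_zero this hv) hsum
  let b := basisOfLinearIndependentOfCardEqFinrank hli (by simp [hE])
  have hb0 : b 0 = v := by simp [b]
  have hb1 : b 1 = w := by simp [b]
  -- In the basis `v, w` the matrix of `A` is upper triangular with diagonal `1, l`. The hypothesis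
  -- becomes `∑ l ^ j = 0`, which rules out `l > 0`.
  set c := b.repr (A w) 0
  set l := b.repr (A w) 1
  have hAw : A w = c • v + l • w := by
    have h := b.sum_repr (A w)
    rw [Fin.sum_univ_two, hb0, hb1] at h
    exact h.symm
  have hdet : LinearMap.det A = l := by
    rw [← LinearMap.det_toMatrix b, Matrix.det_fin_two]
    simp only [LinearMap.toMatrix_apply, hb0, hb1, hAv]
    rw [← hb0]
    simp [l]
  have hpw : ∀ j : ℕ, b.repr ((A ^ j) w) 1 = l ^ j := by
    intro j
    induction j with
    | zero => simp [← hb1]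
    | succ j ih =>
      rw [pow_succ, Module.End.mul_apply, hAw, map_add, map_smul, map_smul, hpow, ← hb0]
      simp [ih, pow_succ, mul_comm]
  have hs : ∑ j ∈ Finset.range N, l ^ j = 0 := by
    have := congrArg (fun u => b.repr u 1) hsum
    simpa [map_sum, Finset.sum_apply', hpw] using this
  rw [hdet]
  by_contra hl
  push Not at hl
  exact (Finset.sum_pos (fun j _ => pow_pos hl j) ⟨0, by simpa using hN⟩).ne' hs

/-- Near a fixed point at which a planar `C¹` map preserves the orientation, points of bounded
period are all fixed or all non-fixed. -/
theorem eventually_fixed_or_eventually_not_fixed (hE : Module.finrank ℝ E = 2) {f : E → E}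
    {A : E →L[ℝ] E} {x : E} (hf : HasStrictFDerivAt f A x) (hx : f x = x)
    (hA : 0 < LinearMap.det A.toLinearMap) {N : ℕ} (hN : 0 < N) {F : Filter E} (hF : F ≤ 𝓝[≠] x)
    (hper : ∀ᶠ u in F, f^[N] u = u) : (∀ᶠ u in F, f u = u) ∨ ∀ᶠ u in F, f u ≠ u := by
  by_contra hcon
  push Not at hcon
  obtain ⟨hmov, hfix⟩ := hcon
  have hF' : Tendsto id F (𝓝 x) := hF.trans nhdsWithin_le_nhds
  have hxne : ∀ᶠ u in F, u ≠ x := hF self_mem_nhdsWithin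
  -- Fixed points accumulating at `x` are zeros of `f - id` distinct from `x`, so its derivative `A
  -- - 1` is not injective.
  obtain ⟨v, hv, hAv⟩ : ∃ v, v ≠ 0 ∧ A v = v := by
    by_contra h
    push Not at h
    have hinj : Function.Injective (A - ContinuousLinearMap.id ℝ E) := by
      rw [injective_iff_map_eq_zero]
      intro v hv
      by_contra hv0
      exact h v hv0 (sub_eq_zero.mp (by simpa using hv))
    have h1 := (hf.sub (hasStrictFDerivAt_id x)).eventually_injective hinj
    have h2 : Tendsto (fun u => (u, x)) F (𝓝 (x, x)) :=
      Tendsto.prodMk_nhds hF' tendsto_const_nhds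
    obtain ⟨u, hu, hu1, hu2⟩ := (hfix.and_eventually ((h2.eventually h1).and hxne)).exists
    refine hu2 (hu1 ?_)
    simp [hx, hu]
  -- The orbit sum takes equal values at `u` and `f u` when `f^[N] u = u`. Moved points accumulating
  -- at `x` therefore prevent its derivative `∑ A ^ j` from being injective.
  obtain ⟨w, hw, hBw⟩ : ∃ w, w ≠ 0 ∧ ∑ j ∈ Finset.range N, (A ^ j) w = 0 := by
    by_contra h
    push Not at h
    have hinj : Function.Injective (∑ j ∈ Finset.range N, A ^ j : E →L[ℝ] E) := by
      rw [injective_iff_map_eq_zero]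
      intro v hv
      by_contra hv0
      exact h v hv0 (by simpa using hv)
    have hS : HasStrictFDerivAt (fun u => ∑ j ∈ Finset.range N, f^[j] u)
        (∑ j ∈ Finset.range N, A ^ j) x :=
      HasStrictFDerivAt.fun_sum fun j _ => hf.iterate hx j
    have h1 := hS.eventually_injective hinj
    have h2 : Tendsto (fun u => (f u, u)) F (𝓝 (x, x)) := by
      refine Tendsto.prodMk_nhds ?_ hF'
      have := hf.continuousAt.tendsto.comp hF'
      rwa [hx] at this
    obtain ⟨u, hu, hu1, hu2⟩ := (hmov.and_eventually ((h2.eventually h1).and hper)).exists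
    refine hu (hu1 ?_)
    simp only [← Function.iterate_succ_apply]
    rw [← sub_eq_zero, ← Finset.sum_sub_distrib, Finset.sum_range_sub (fun j => f^[j] u)]
    simp [hu2]
  refine absurd hA (not_lt.mpr (det_nonpos_of_fixed_of_sum_eq_zero hE A.toLinearMap hv hAv hw hN ?_))
  rw [← hBw]
  refine Finset.sum_congr rfl fun j hj => ?_
  clear hj
  induction j with
  | zero => rfl
  | succ j ih => rw [pow_succ', pow_succ', Module.End.mul_apply, ih]; rfl

end LinearAlgebra

/-! ### The leaf topology and plaques -/

section LeafTopology

variable {p : ℕ} {M : Type*} [TopologicalSpace M] [ChartedSpace (Model p) M]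

variable (p) in
/-- The transverse coordinate of `z` in the preferred chart at `c`. -/
noncomputable def transCoord (c z : M) : EuclideanHalfSpace 2 := (chartAt (Model p) c z).2

theorem mem_leaf_self (m : M) : m ∈ leaf p m :=
  @mem_connectedComponent M (leafTopology p M) m

theorem leaf_eq_of_mem {m m' : M} (h : m' ∈ leaf p m) : leaf p m' = leaf p m :=
  (@connectedComponent_eq M (leafTopology p M) _ _ h).symm

omit [ChartedSpace (Model p) M] in
theorem continuousAt_transverse {e : OpenPartialHomeomorph M (Model p)} {m : M}
    (hm : m ∈ e.source) : ContinuousAt (fun z => (e z).2) m :=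
  continuous_snd.continuousAt.comp (e.continuousAt hm)

variable [IsFoliated p M]

theorem eventually_transverse_eq {e e' : OpenPartialHomeomorph M (Model p)}
    (he : e ∈ atlas (Model p) M) (he' : e' ∈ atlas (Model p) M) {m : M} (hm : m ∈ e.source)
    (hm' : m ∈ e'.source) :
    ∀ᶠ q in 𝓝 (m, m), (e q.1).2 = (e q.2).2 → (e' q.1).2 = (e' q.2).2 := by
  obtain ⟨N, hN, h⟩ := IsFoliated.transverse_coord e he e' he' (e m)
    (by simp [hm, hm'])
  have h1 : ∀ᶠ z in 𝓝 m, e z ∈ N ∧ z ∈ e.source :=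
    ((e.continuousAt hm).eventually hN).and (e.open_source.mem_nhds hm)
  rw [nhds_prod_eq]
  filter_upwards [h1.prod_mk h1] with q hq hqq
  have := h _ hq.1.1 _ hq.2.1 hqq
  rwa [e.left_inv hq.1.2, e.left_inv hq.2.2] at this

theorem eventually_transverse_iff {e e' : OpenPartialHomeomorph M (Model p)}
    (he : e ∈ atlas (Model p) M) (he' : e' ∈ atlas (Model p) M) {m : M} (hm : m ∈ e.source)
    (hm' : m ∈ e'.source) :
    ∀ᶠ q in 𝓝 (m, m), (e q.1).2 = (e q.2).2 ↔ (e' q.1).2 = (e' q.2).2 := by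
  filter_upwards [eventually_transverse_eq he he' hm hm',
    eventually_transverse_eq he' he hm' hm] with q h h' using ⟨h, h'⟩

/-- The leaf topology is locally the subspace topology of the plaques. -/
theorem nhds_leafTopology {e : OpenPartialHomeomorph M (Model p)} (he : e ∈ atlas (Model p) M)
    {m : M} (hm : m ∈ e.source) :
    @nhds M (leafTopology p M) m = 𝓝[{z | (e z).2 = (e m).2}] m := by
  rw [leafTopology, TopologicalSpace.nhds_generateFrom]
  apply le_antisymm
  · intro s hs
    obtain ⟨V, hV, hmV, hVs⟩ := mem_nhdsWithin.mp hs
    refine mem_iInf_of_mem {z | z ∈ e.source ∧ z ∈ V ∧ (e z).2 = (e m).2} ?_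
    refine mem_iInf_of_mem ⟨⟨hm, hmV, rfl⟩, e, he, V, hV, _, rfl⟩ ?_
    exact fun z hz => hVs ⟨hz.2.1, hz.2.2⟩
  · refine le_iInf₂ ?_
    rintro _ ⟨hmP, e', he', V, hV, y, rfl⟩
    rw [le_principal_iff, mem_nhdsWithin_iff_eventually]
    have h1 : Tendsto (fun z => (z, m)) (𝓝 m) (𝓝 (m, m)) :=
      (by fun_prop : Continuous fun z : M => (z, m)).tendsto m
    filter_upwards [h1.eventually (eventually_transverse_eq he he' hm hmP.1),
      e'.open_source.mem_nhds hmP.1, hV.mem_nhds hmP.2.1] with z hz hz1 hz2 hzm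
    exact ⟨hz1, hz2, (hz hzm).trans hmP.2.2⟩

theorem nhds_leafTopology_chartAt (m : M) :
    @nhds M (leafTopology p M) m = 𝓝[{z | transCoord p m z = transCoord p m m}] m :=
  nhds_leafTopology (chart_mem_atlas _ m) (mem_chart_source _ m)

variable (p M) in
theorem leafTopology_le : leafTopology p M ≤ ‹TopologicalSpace M› := by
  refine le_of_nhds_le_nhds fun m => ?_
  rw [nhds_leafTopology_chartAt]
  exact nhdsWithin_le_nhds

theorem IsCompactLeaf.isCompact {L : Set M} (h : IsCompactLeaf p L) : IsCompact L := by
  have := @IsCompact.image M M (leafTopology p M) _ L id h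
    (continuous_id_iff_le.mpr (leafTopology_le p M))
  simpa using this

/-- A path moving in one plaque is continuous in the leaf topology. -/
theorem continuous_leafTopology_of_plaque {X : Type*} [TopologicalSpace X] {f : X → M}
    (hf : Continuous f) {e : OpenPartialHomeomorph M (Model p)} (he : e ∈ atlas (Model p) M)
    (hs : ∀ x, f x ∈ e.source) {y : EuclideanHalfSpace 2} (hy : ∀ x, (e (f x)).2 = y) :
    Continuous[_, leafTopology p M] f := by
  refine (@continuous_iff_continuousAt X M _ (leafTopology p M) f).mpr fun x => ?_
  change Tendsto f (𝓝 x) (@nhds M (leafTopology p M) (f x))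
  rw [nhds_leafTopology he (hs x)]
  exact tendsto_nhdsWithin_iff.mpr ⟨hf.continuousAt, Eventually.of_forall fun z => by
    simp [hy]⟩

omit [IsFoliated p M] in
theorem mem_leaf_of_path {γ : I → M} (h : Continuous[_, leafTopology p M] γ) :
    γ 1 ∈ leaf p (γ 0) := by
  let _ := leafTopology p M
  exact (isPreconnected_range h).subset_connectedComponent ⟨0, rfl⟩ ⟨1, rfl⟩

end LeafTopology

/-! ### Transport germs along leaves -/

section Transport

variable {p : ℕ} {M : Type*} [TopologicalSpace M] [ChartedSpace (Model p) M]

variable (p) in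
/-- The `C¹` germ `φ` at `a` moves the points near `a` inside their leaves, by paths depending
continuously on the point, and is transversally injective. -/
structure IsTransport (φ : M → M) (a : M) : Prop where
  exists_homotopy : ∃ U ∈ 𝓝 a, ∃ Φ : M × I → M, ContinuousOn Φ (U ×ˢ univ) ∧
    (∀ z ∈ U, Continuous[_, leafTopology p M] fun s => Φ (z, s)) ∧
    ∀ z ∈ U, Φ (z, 0) = z ∧ Φ (z, 1) = φ z
  contMDiffAt : ContMDiffAt (corners p) (corners p) 1 φ a
  transverse : ∀ᶠ q in 𝓝 (a, a), transCoord p (φ a) (φ q.1) = transCoord p (φ a) (φ q.2) ↔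
    transCoord p a q.1 = transCoord p a q.2

namespace IsTransport

variable {φ χ : M → M} {a b : M}

theorem continuousAt (h : IsTransport p φ a) : ContinuousAt φ a := h.contMDiffAt.continuousAt

theorem eventually_mem_leaf [IsFoliated p M] (h : IsTransport p φ a) :
    ∀ᶠ z in 𝓝 a, φ z ∈ leaf p z := by
  obtain ⟨U, hU, Φ, -, h2, h3⟩ := h.exists_homotopy
  filter_upwards [hU] with z hz
  have := mem_leaf_of_path (h2 z hz)
  simpa only [h3 z hz] using this

theorem mem_leaf [IsFoliated p M] (h : IsTransport p φ a) : φ a ∈ leaf p a :=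
  h.eventually_mem_leaf.self_of_nhds

theorem congr (h : IsTransport p φ a) (hφ : φ =ᶠ[𝓝 a] χ) : IsTransport p χ a := by
  refine ⟨?_, h.contMDiffAt.congr_of_eventuallyEq hφ.symm, ?_⟩
  · obtain ⟨U, hU, Φ, h1, h2, h3⟩ := h.exists_homotopy
    refine ⟨U ∩ {z | φ z = χ z}, inter_mem hU hφ, Φ, h1.mono ?_, fun z hz => h2 z hz.1,
      fun z hz => ⟨(h3 z hz.1).1, (h3 z hz.1).2.trans hz.2⟩⟩
    exact prod_mono_left inter_subset_left
  · have := h.transverse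
    rw [nhds_prod_eq] at this ⊢
    filter_upwards [this, hφ.prod_mk hφ] with q hq hq'
    rw [← hq'.1, ← hq'.2, ← hφ.self_of_nhds]
    exact hq

theorem comp (hχ : IsTransport p χ (φ a)) (hφ : IsTransport p φ a) :
    IsTransport p (χ ∘ φ) a := by
  refine ⟨?_, hχ.contMDiffAt.comp a hφ.contMDiffAt, ?_⟩
  · obtain ⟨U, hU, Φ, h1, h2, h3⟩ := hφ.exists_homotopy
    obtain ⟨V, hV, Ψ, k1, k2, k3⟩ := hχ.exists_homotopy
    obtain ⟨W, hW, hWc⟩ : ∃ W ∈ 𝓝 a, ContinuousOn φ W := by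
      refine ⟨U, hU, ?_⟩
      have : ContinuousOn (fun z => Φ (z, 1)) U :=
        h1.comp (by fun_prop) fun z hz => ⟨hz, mem_univ _⟩
      exact this.congr fun z hz => (h3 z hz).2.symm
    -- The two homotopies run one after the other at double speed; `projIcc` clamps the time outside
    -- the relevant half.
    let l : I → I := fun s => projIcc 0 1 zero_le_one (2 * (s : ℝ))
    let r : I → I := fun s => projIcc 0 1 zero_le_one (2 * (s : ℝ) - 1)
    have hl : Continuous l := continuous_projIcc.comp (by fun_prop)
    have hr : Continuous r := continuous_projIcc.comp (by fun_prop)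
    have hl0 : l 0 = 0 := by simp [l]
    have hr1 : r 1 = 1 := by
      simp only [r]
      rw [show (2 * ((1 : I) : ℝ) - 1) = 1 by norm_num]
      exact projIcc_right _
    have hlh : ∀ s : I, (s : ℝ) = 1 / 2 → l s = 1 := fun s hs => by
      simp only [l]
      rw [show (2 * (s : ℝ)) = 1 by rw [hs]; norm_num]
      exact projIcc_right _
    have hrh : ∀ s : I, (s : ℝ) = 1 / 2 → r s = 0 := fun s hs => by
      simp only [r]
      rw [show (2 * (s : ℝ) - 1) = 0 by rw [hs]; norm_num]
      exact projIcc_left _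
    have hmid : ∀ z ∈ U ∩ W ∩ φ ⁻¹' V, ∀ s : I, (s : ℝ) = 1 / 2 →
        Φ (z, l s) = Ψ (φ z, r s) := fun z hz s hs => by
      rw [hlh s hs, hrh s hs, (h3 z hz.1.1).2, (k3 _ hz.2).1]
    refine ⟨U ∩ W ∩ φ ⁻¹' V, inter_mem (inter_mem hU hW) (hφ.continuousAt hV),
      fun q => if (q.2 : ℝ) ≤ 1 / 2 then Φ (q.1, l q.2) else Ψ (φ q.1, r q.2), ?_, ?_, ?_⟩
    · rw [continuousOn_iff_continuous_domRestrict]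
      refine Continuous.if_le (f' := fun q : ((U ∩ W ∩ φ ⁻¹' V) ×ˢ (univ : Set I) : Set (M × I)) =>
        Φ (q.1.1, l q.1.2)) (g' := fun q => Ψ (φ q.1.1, r q.1.2)) ?_ ?_ (by fun_prop) continuous_const ?_
      · exact h1.comp_continuous (by fun_prop) fun q => ⟨q.2.1.1.1, mem_univ _⟩
      · refine k1.comp_continuous (Continuous.prodMk ?_ (by fun_prop))
          fun q => ⟨q.2.1.2, mem_univ _⟩
        exact hWc.comp_continuous (by fun_prop) fun q => q.2.1.1.2
      · exact fun q hq => hmid _ q.2.1 _ hq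
    · intro z hz
      have c1 := @Continuous.comp I I M _ _ (leafTopology p M) _ _ (h2 z hz.1.1) hl
      have c2 := @Continuous.comp I I M _ _ (leafTopology p M) _ _ (k2 _ hz.2) hr
      let := leafTopology p M
      exact Continuous.if_le (f := fun s : I => (s : ℝ)) (g := fun _ => (1 / 2 : ℝ)) c1 c2
        continuous_subtype_val continuous_const (fun s hs => hmid z hz s hs)
    · intro z hz
      constructor
      · simp [hl0, (h3 z hz.1.1).1]
      · have : ¬ (((1 : I) : ℝ) ≤ 1 / 2) := by norm_num
        simp only [if_neg this, hr1, (k3 _ hz.2).2, Function.comp]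
  · have := (hφ.continuousAt.prodMap' hφ.continuousAt).eventually hχ.transverse
    filter_upwards [this, hφ.transverse] with q h1 h2
    exact h1.trans h2

variable [IsFoliated p M]

/-- The preferred chart varies with the point, so spreading the transversality condition to nearby
points requires its independence of the charts. -/
theorem transverse_iff {e e' : OpenPartialHomeomorph M (Model p)} (he : e ∈ atlas (Model p) M)
    (he' : e' ∈ atlas (Model p) M) (ha : a ∈ e.source) (hb : φ a ∈ e'.source)
    (hφ : ContinuousAt φ a) :
    (∀ᶠ q in 𝓝 (a, a), (e' (φ q.1)).2 = (e' (φ q.2)).2 ↔ (e q.1).2 = (e q.2).2) ↔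
    ∀ᶠ q in 𝓝 (a, a), transCoord p (φ a) (φ q.1) = transCoord p (φ a) (φ q.2) ↔
      transCoord p a q.1 = transCoord p a q.2 := by
  have h1 := eventually_transverse_iff he (chart_mem_atlas _ a) ha (mem_chart_source _ a)
  have h2 := (hφ.prodMap' hφ).eventually
    (eventually_transverse_iff he' (chart_mem_atlas _ (φ a)) hb (mem_chart_source _ (φ a)))
  refine eventually_congr ?_
  filter_upwards [h1, h2] with q h1 h2
  exact iff_congr h2 h1

/-- A transport germ is a transport germ at all nearby points. -/
theorem eventually (h : IsTransport p φ a) : ∀ᶠ z in 𝓝 a, IsTransport p φ z := by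
  obtain ⟨U, hU, Φ, h1, h2, h3⟩ := h.exists_homotopy
  have hT := h.transverse.eventually_nhds
  have hdiag : Tendsto (fun z => (z, z)) (𝓝 a) (𝓝 (a, a)) := by
    rw [nhds_prod_eq]; exact tendsto_id.prodMk tendsto_id
  filter_upwards [eventually_mem_nhds_iff.mpr hU, (contMDiffAt_iff_contMDiffAt_nhds (by simp)).mp h.contMDiffAt,
    hdiag.eventually hT, (chartAt (Model p) a).open_source.mem_nhds (mem_chart_source _ a),
    h.continuousAt ((chartAt (Model p) (φ a)).open_source.mem_nhds (mem_chart_source _ (φ a)))]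
    with z hz1 hz2 hz3 hz4 hz5
  exact ⟨⟨U, hz1, Φ, h1, h2, h3⟩, hz2, (transverse_iff (chart_mem_atlas _ a)
    (chart_mem_atlas _ (φ a)) hz4 hz5 (ContMDiffAt.continuousAt hz2)).mp hz3⟩

theorem contMDiffAt_transverse {e : OpenPartialHomeomorph M (Model p)}
    (he : e ∈ atlas (Model p) M) {m : M} (hm : m ∈ e.source) :
    ContMDiffAt (corners p) (𝓡∂ 2) 1 (fun z => (e z).2) m := by
  have h1 : ContMDiffAt (corners p) (corners p) 1 e m :=
    contMDiffAt_of_mem_maximalAtlas (IsManifold.subset_maximalAtlas he) hm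
  have h2 : ContMDiffAt (corners p) (𝓡∂ 2) 1 (fun z : Model p => z.2) (e m) := by
    have h : ContMDiffAt ((𝓡 p).prod (𝓡∂ 2)) (𝓡∂ 2) 1
        (Prod.snd : EuclideanSpace ℝ (Fin p) × EuclideanHalfSpace 2 → _) (e m) := contMDiffAt_snd
    rw [chartedSpaceSelf_prod] at h
    exact h
  exact h2.comp m h1

theorem contMDiffAt_section {e : OpenPartialHomeomorph M (Model p)}
    (he : e ∈ atlas (Model p) M) {F : EuclideanHalfSpace 2 → EuclideanSpace ℝ (Fin p)}
    {y : EuclideanHalfSpace 2} (hF : ContMDiffAt (𝓡∂ 2) (𝓡 p) 1 F y)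
    (hy : ((F y, y) : Model p) ∈ e.target) :
    ContMDiffAt (𝓡∂ 2) (corners p) 1 (fun u => e.symm ((F u, u) : Model p)) y := by
  have h1 : ContMDiffAt (corners p) (corners p) 1 e.symm ((F y, y) : Model p) :=
    contMDiffAt_symm_of_mem_maximalAtlas (IsManifold.subset_maximalAtlas he) hy
  let G : EuclideanHalfSpace 2 → Model p := fun u => (F u, u)
  have h2 : ContMDiffAt (𝓡∂ 2) (corners p) 1 G y := by
    have h := hF.prodMk (contMDiffAt_id : ContMDiffAt (𝓡∂ 2) (𝓡∂ 2) 1 id y)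
    rw [chartedSpaceSelf_prod] at h
    exact h
  exact ContMDiffAt.comp (g := e.symm) (f := G) y h1 h2

end IsTransport

end Transport

/-! ### Existence of transport germs -/

section BasicTransports

variable {p : ℕ} {M : Type*} [TopologicalSpace M] [ChartedSpace (Model p) M] [IsFoliated p M]

/-- Moving along straight segments of the plaques of a foliated chart onto the graph of `F`. -/
theorem IsTransport.of_section {e : OpenPartialHomeomorph M (Model p)} (he : e ∈ atlas (Model p) M)
    {a : M} (ha : a ∈ e.source) {B : Set (EuclideanSpace ℝ (Fin p))} (hB : IsOpen B)
    (hBc : Convex ℝ B) {V : Set (EuclideanHalfSpace 2)} (hV : IsOpen V)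
    (hBV : ∀ x ∈ B, ∀ y ∈ V, ((x, y) : Model p) ∈ e.target) (haB : (e a).1 ∈ B)
    (haV : (e a).2 ∈ V) {F : EuclideanHalfSpace 2 → EuclideanSpace ℝ (Fin p)}
    (hF : ContMDiffAt (𝓡∂ 2) (𝓡 p) 1 F (e a).2) (hFB : F (e a).2 ∈ B) :
    IsTransport p (fun z => e.symm ((F (e z).2, (e z).2) : Model p)) a := by
  let U : Set M := {z | z ∈ e.source ∧ (e z).1 ∈ B ∧ (e z).2 ∈ V ∧ F (e z).2 ∈ B ∧
    ContinuousAt F (e z).2}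
  have h2 : ContinuousAt (fun z => (e z).2) a := continuousAt_transverse ha
  have h1 : ContinuousAt (fun z => (e z).1) a :=
    continuous_fst.continuousAt.comp (e.continuousAt ha)
  have hFc : ∀ᶠ u in 𝓝 (e a).2, ContinuousAt F u :=
    ((contMDiffAt_iff_contMDiffAt_nhds (by simp)).mp hF).mono fun u hu =>
      ContMDiffAt.continuousAt hu
  have hU : U ∈ 𝓝 a := by
    filter_upwards [e.open_source.mem_nhds ha, h1 (hB.mem_nhds haB), h2 (hV.mem_nhds haV),
      h2.eventually hFc, (ContinuousAt.comp (g := F) (f := fun z => (e z).2) hF.continuousAt h2) (hB.mem_nhds hFB)] with z z1 z2 z3 z4 z5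
    exact ⟨z1, z2, z3, z5, z4⟩
  have hseg : ∀ z ∈ U, ∀ s : I,
      (((1 - (s : ℝ)) • (e z).1 + (s : ℝ) • F (e z).2, (e z).2) : Model p) ∈ e.target :=
    fun z hz s => hBV _ (hBc hz.2.1 hz.2.2.2.1 (by linarith [s.2.2]) s.2.1 (by ring)) _ hz.2.2.1
  have hend : ∀ z ∈ U, ((F (e z).2, (e z).2) : Model p) ∈ e.target := fun z hz =>
    hBV _ hz.2.2.2.1 _ hz.2.2.1
  have haU : a ∈ U := mem_of_mem_nhds hU
  have hφ : ContMDiffAt (corners p) (corners p) 1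
      (fun z => e.symm ((F (e z).2, (e z).2) : Model p)) a :=
    ContMDiffAt.comp (g := fun u => e.symm ((F u, u) : Model p)) (f := fun z => (e z).2) a
      (IsTransport.contMDiffAt_section he hF (hend a haU)) (IsTransport.contMDiffAt_transverse he ha)
  refine ⟨⟨U, hU, fun q => e.symm
    (((1 - (q.2 : ℝ)) • (e q.1).1 + (q.2 : ℝ) • F (e q.1).2, (e q.1).2) : Model p), ?_, ?_, ?_⟩,
    ?_, ?_⟩
  · rintro ⟨z, s⟩ ⟨hz, -⟩
    refine ContinuousAt.continuousWithinAt ?_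
    let G : M × I → Model p := fun q =>
      ((1 - (q.2 : ℝ)) • (e q.1).1 + (q.2 : ℝ) • F (e q.1).2, (e q.1).2)
    have hfst : ContinuousAt (fun q : M × I => q.1) (z, s) := continuousAt_fst
    have c1 : ContinuousAt (fun q : M × I => (e q.1).1) (z, s) :=
      (continuous_fst.continuousAt.comp (e.continuousAt hz.1)).comp_of_eq hfst rfl
    have c2 : ContinuousAt (fun q : M × I => (e q.1).2) (z, s) :=
      (continuousAt_transverse hz.1).comp_of_eq hfst rfl
    have c3 : ContinuousAt (fun q : M × I => F (e q.1).2) (z, s) :=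
      hz.2.2.2.2.comp_of_eq c2 rfl
    have c4 : ContinuousAt (fun q : M × I => (q.2 : ℝ)) (z, s) := by fun_prop
    have hG : ContinuousAt G (z, s) :=
      (((continuousAt_const.sub c4).smul c1).add (c4.smul c3)).prodMk c2
    exact (e.continuousAt_symm (hseg z hz s)).comp_of_eq hG rfl
  · intro z hz
    refine continuous_leafTopology_of_plaque (e := e) (y := (e z).2) ?_ he
      (fun s => e.map_target (hseg z hz s)) (fun s => by rw [e.right_inv (hseg z hz s)])
    let G : I → Model p := fun s => ((1 - (s : ℝ)) • (e z).1 + (s : ℝ) • F (e z).2, (e z).2)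
    have hG : Continuous G := Continuous.prodMk (by fun_prop) continuous_const
    exact e.continuousOn_symm.comp_continuous hG fun s => hseg z hz s
  · intro z hz
    constructor
    · simp [e.left_inv hz.1]
    · simp
  · exact hφ
  · refine (IsTransport.transverse_iff he he ha (e.map_target (hend a haU)) hφ.continuousAt).mp ?_
    rw [nhds_prod_eq]
    filter_upwards [prod_mem_prod hU hU] with q hq
    rw [e.right_inv (hend _ hq.1), e.right_inv (hend _ hq.2)]

omit [IsFoliated p M] in
theorem isTransport_id (a : M) : IsTransport p id a := by
  refine ⟨⟨univ, univ_mem, fun q => q.1, continuous_fst.continuousOn, fun z _ => ?_,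
    fun z _ => ⟨rfl, rfl⟩⟩, contMDiffAt_id, by simp⟩
  exact @continuous_const I M _ (leafTopology p M) z

variable (p) in
omit [IsFoliated p M] in
theorem exists_box (a : M) : ∃ B : Set (EuclideanSpace ℝ (Fin p)), IsOpen B ∧ Convex ℝ B ∧
    ∃ V : Set (EuclideanHalfSpace 2), IsOpen V ∧
    (∀ x ∈ B, ∀ y ∈ V, ((x, y) : Model p) ∈ (chartAt (Model p) a).target) ∧
    (chartAt (Model p) a a).1 ∈ B ∧ (chartAt (Model p) a a).2 ∈ V := by
  have h := (chartAt (Model p) a).open_target.mem_nhds (mem_chart_target _ a)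
  obtain ⟨u, hu, V, hV, huV⟩ := mem_nhds_prod_iff.mp h
  obtain ⟨ε, hε, hεu⟩ := Metric.mem_nhds_iff.mp hu
  obtain ⟨V', hV', hVo, haV⟩ := mem_nhds_iff.mp hV
  exact ⟨Metric.ball _ ε, Metric.isOpen_ball, convex_ball _ _, V', hVo,
    fun x hx y hy => huV ⟨hεu hx, hV' hy⟩, Metric.mem_ball_self hε, haV⟩

/-- The endpoints of transport germs at `a` form a clopen set in the leaf topology: inside a box of
a chart, `IsTransport.of_section` with a constant section moves any point of a plaque to any other.
-/
theorem exists_isTransport {a b : M} (h : b ∈ leaf p a) :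
    ∃ φ, IsTransport p φ a ∧ φ a = b := by
  let s : Set M := {b | ∃ φ, IsTransport p φ a ∧ φ a = b}
  have key : ∀ b₀, ∃ P ∈ @nhds M (leafTopology p M) b₀, ∀ b ∈ P, ∀ b' ∈ P, b ∈ s → b' ∈ s := by
    intro b₀
    set e := chartAt (Model p) b₀
    obtain ⟨B, hB, hBc, V, hV, hBV, h1, h2⟩ := exists_box p b₀
    refine ⟨{z | z ∈ e.source ∧ (e z).1 ∈ B ∧ (e z).2 = (e b₀).2}, ?_, ?_⟩
    · rw [nhds_leafTopology (chart_mem_atlas _ b₀) (mem_chart_source _ b₀)]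
      have c1 : ContinuousAt (fun z => (e z).1) b₀ :=
        continuous_fst.continuousAt.comp (e.continuousAt (mem_chart_source _ b₀))
      rw [mem_nhdsWithin_iff_eventually]
      filter_upwards [e.open_source.mem_nhds (mem_chart_source _ b₀), c1 (hB.mem_nhds h1)]
        with z z1 z2 z3 using ⟨z1, z2, z3⟩
    · rintro b hb b' hb' ⟨φ, hφ, rfl⟩
      refine ⟨_, IsTransport.comp (IsTransport.of_section (chart_mem_atlas _ b₀) hb.1 hB hBc hV hBV
        hb.2.1 (by rw [hb.2.2]; exact h2) (F := fun _ => (e b').1) contMDiffAt_const hb'.2.1) hφ, ?_⟩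
      change e.symm (((e b').1, (e (φ a)).2) : Model p) = b'
      rw [hb.2.2, ← hb'.2.2]
      exact e.left_inv hb'.1
  have hclopen : @IsClopen M (leafTopology p M) s := by
    constructor
    · refine (@isOpen_compl_iff M s (leafTopology p M)).mp ?_
      refine (@isOpen_iff_mem_nhds M (leafTopology p M) _).mpr fun b hb => ?_
      obtain ⟨P, hP, h⟩ := key b
      exact mem_of_superset hP fun b' hb' hs =>
        hb (h b' hb' b (@mem_of_mem_nhds M (leafTopology p M) _ _ hP) hs)
    · refine (@isOpen_iff_mem_nhds M (leafTopology p M) _).mpr fun b hb => ?_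
      obtain ⟨P, hP, h⟩ := key b
      exact mem_of_superset hP fun b' hb' =>
        h b (@mem_of_mem_nhds M (leafTopology p M) _ _ hP) b' hb' hb
  exact @IsClopen.connectedComponent_subset M (leafTopology p M) s a hclopen
    ⟨id, isTransport_id a, rfl⟩ b h

end BasicTransports

/-! ### Transverse surfaces as local sections -/

theorem exists_contDiffAt_inverse {E : Type*} [NormedAddCommGroup E] [NormedSpace ℝ E]
    [FiniteDimensional ℝ E] {f : E → E} {x : E} (hf : ContDiffAt ℝ 1 f x)
    (hs : Function.Surjective (fderiv ℝ f x)) :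
    ∃ k : E → E, ContDiffAt ℝ 1 k (f x) ∧ k (f x) = x ∧ (∀ᶠ v in 𝓝 x, k (f v) = v) ∧
      ∀ᶠ u in 𝓝 (f x), f (k u) = u := by
  have := FiniteDimensional.complete ℝ E
  have hs' : Function.Surjective (fderiv ℝ f x).toLinearMap := hs
  let A : E ≃L[ℝ] E := (LinearEquiv.ofBijective (fderiv ℝ f x).toLinearMap
    ⟨LinearMap.injective_iff_surjective.mpr hs', hs'⟩).toContinuousLinearEquiv
  have hA : HasFDerivAt f (A : E →L[ℝ] E) x := by
    convert! (hf.differentiableAt (by simp)).hasFDerivAt using 1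
  have hsA : HasStrictFDerivAt f (A : E →L[ℝ] E) x := hf.hasStrictFDerivAt' hA (by simp)
  exact ⟨hsA.localInverse f A x, hf.to_localInverse hA (by simp), hsA.localInverse_apply_image,
    hsA.eventually_left_inverse, hsA.eventually_right_inverse⟩

section Transversal

variable {p : ℕ} {M : Type*} [TopologicalSpace M] [ChartedSpace (Model p) M] [IsFoliated p M]
  {T : Set M} [ChartedSpace (EuclideanHalfSpace 2) T]

theorem contMDiffAt_transCoord (m : M) :
    ContMDiffAt (corners p) (𝓡∂ 2) 1 (transCoord p m) m :=
  IsTransport.contMDiffAt_transverse (chart_mem_atlas _ m) (mem_chart_source _ m)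

theorem hasMFDerivAt_transCoord (m : M) :
    HasMFDerivAt (corners p) (𝓡∂ 2) (transCoord p m) m
      (ContinuousLinearMap.snd ℝ (EuclideanSpace ℝ (Fin p)) (EuclideanSpace ℝ (Fin 2))) := by
  have h : ∀ w ∈ (extChartAt (corners p) m).target,
      (𝓡∂ 2) (transCoord p m ((extChartAt (corners p) m).symm w)) = w.2 := fun w hw =>
    congrArg Prod.snd ((extChartAt (corners p) m).right_inv hw)
  refine ⟨(contMDiffAt_transCoord m).continuousAt, ?_⟩
  have h' : HasFDerivWithinAt (fun w : EuclideanSpace ℝ (Fin p) × EuclideanSpace ℝ (Fin 2) => w.2)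
    (ContinuousLinearMap.snd ℝ (EuclideanSpace ℝ (Fin p)) (EuclideanSpace ℝ (Fin 2)))
    (range (corners p)) (extChartAt (corners p) m m) := hasFDerivWithinAt_snd
  refine h'.congr_of_eventuallyEq ?_ ?_
  · filter_upwards [extChartAt_target_mem_nhdsWithin m] with w hw using h w hw
  · exact h _ (mem_extChartAt_target m)

/-- By transversality every vector is tangent to `T` up to a leaf vector, and leaf vectors die under
the transverse projection. -/
theorem surjective_mfderiv_transCoord (hT : IsTransverseSurface p T) (t : T) :
    Function.Surjective
      (mfderiv (𝓡∂ 2) (𝓡∂ 2) (fun w : T => transCoord p (t : M) (w : M)) t) := by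
  obtain ⟨-, h2, h3⟩ := hT
  have hd : mfderiv (𝓡∂ 2) (𝓡∂ 2) (fun w : T => transCoord p (t : M) (w : M)) t =
      (ContinuousLinearMap.snd ℝ (EuclideanSpace ℝ (Fin p)) (EuclideanSpace ℝ (Fin 2))).comp
        (mfderiv (𝓡∂ 2) (corners p) (Subtype.val : T → M) t) :=
    (HasMFDerivAt.comp t (hasMFDerivAt_transCoord (t : M))
      ((h2 t).mdifferentiableAt (by simp)).hasMFDerivAt).mfderiv
  rw [hd]
  intro w
  let q : TangentSpace (corners p) (t : M) :=
    ((0, w) : EuclideanSpace ℝ (Fin p) × EuclideanSpace ℝ (Fin 2))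
  have hq : q ∈ LinearMap.range (mfderiv (𝓡∂ 2) (corners p) (Subtype.val : T → M) t).toLinearMap ⊔
      leafTangent p (t : M) := by
    rw [(h3 t).codisjoint.eq_top]; exact Submodule.mem_top
  obtain ⟨a, ⟨v, rfl⟩, b, hb, hab⟩ := Submodule.mem_sup.mp hq
  have hb' : (b : EuclideanSpace ℝ (Fin p) × EuclideanSpace ℝ (Fin 2)).2 = 0 := hb
  have h4 : (mfderiv (𝓡∂ 2) (corners p) (Subtype.val : T → M) t v :
      EuclideanSpace ℝ (Fin p) × EuclideanSpace ℝ (Fin 2)).2 +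
      (b : EuclideanSpace ℝ (Fin p) × EuclideanSpace ℝ (Fin 2)).2 = w := congrArg Prod.snd hab
  rw [hb', add_zero] at h4
  exact ⟨v, h4⟩

/-- A transverse surface is locally, at interior points, the graph of a `C¹` section of the
transverse coordinate. -/
theorem exists_section (hT : IsTransverseSurface p T) {t : T} (ht : (𝓡∂ 2).IsInteriorPoint t) :
    ∃ s : EuclideanHalfSpace 2 → T,
      ContMDiffAt (𝓡∂ 2) (𝓡∂ 2) 1 s (transCoord p (t : M) (t : M)) ∧
      s (transCoord p (t : M) (t : M)) = t ∧
      (∀ᶠ w : T in 𝓝 t, s (transCoord p (t : M) (w : M)) = w) ∧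
      ∀ᶠ u in 𝓝 (transCoord p (t : M) (t : M)), transCoord p (t : M) (s u : M) = u := by
  have hTm : IsManifold (𝓡∂ 2) 1 T := hT.1
  set g : T → EuclideanHalfSpace 2 := fun w => transCoord p (t : M) (w : M) with hgdef
  have hg : ContMDiffAt (𝓡∂ 2) (𝓡∂ 2) 1 g t := (contMDiffAt_transCoord (t : M)).comp t (hT.2.1 t)
  set x₀ := extChartAt (𝓡∂ 2) t t with hx₀
  set f : EuclideanSpace ℝ (Fin 2) → EuclideanSpace ℝ (Fin 2) :=
    fun v => (𝓡∂ 2) (g ((extChartAt (𝓡∂ 2) t).symm v)) with hfdef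
  -- At an interior point the half plane is a neighbourhood of `x₀`, so the ordinary inverse
  -- function theorem in the plane applies.
  have hrange : range (𝓡∂ 2) ∈ 𝓝 x₀ := range_mem_nhds_isInteriorPoint ht
  have hwr : f = writtenInExtChartAt (𝓡∂ 2) (𝓡∂ 2) t g := by
    rfl
  have hf : ContDiffAt ℝ 1 f x₀ := by
    have h := (contMDiffAt_iff.mp hg).2.contDiffAt hrange
    rw [hwr]
    exact h
  have hdf : fderiv ℝ f x₀ = mfderiv (𝓡∂ 2) (𝓡∂ 2) g t := by
    have h : mfderiv (𝓡∂ 2) (𝓡∂ 2) g t = fderivWithin ℝ f (range (𝓡∂ 2)) x₀ :=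
      if_pos (hg.mdifferentiableAt (by simp))
    rw [h, fderivWithin_of_mem_nhds hrange]
  have hsurj : Function.Surjective (fderiv ℝ f x₀) := by
    have := surjective_mfderiv_transCoord hT t
    rw [← hgdef, ← hdf] at this
    exact this
  obtain ⟨k, hk, hk0, hkl, hkr⟩ := exists_contDiffAt_inverse hf hsurj
  have hfx₀ : f x₀ = (𝓡∂ 2) (g t) :=
    congrArg (fun w => (𝓡∂ 2) (g w)) (extChartAt_to_inv t)
  rw [hfx₀] at hk hk0 hkr
  have hsymm : (extChartAt (𝓡∂ 2) t).symm x₀ = t := extChartAt_to_inv t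
  refine ⟨fun u => (extChartAt (𝓡∂ 2) t).symm (k ((𝓡∂ 2) u)),
    ?_, ?_, ?_, ?_⟩
  · have h1 : ContMDiffAt (𝓡∂ 2) 𝓘(ℝ, EuclideanSpace ℝ (Fin 2)) 1 (𝓡∂ 2) (g t) :=
      ModelWithCorners.contMDiff _ (g t)
    have h2 : ContMDiffAt 𝓘(ℝ, EuclideanSpace ℝ (Fin 2)) (𝓡∂ 2) 1 (extChartAt (𝓡∂ 2) t).symm
        x₀ := (contMDiffWithinAt_extChartAt_symm_range_self t).contMDiffAt hrange
    have h3 := hk.contMDiffAt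
    rw [← hk0] at h2
    exact ContMDiffAt.comp (g := fun v => (extChartAt (𝓡∂ 2) t).symm (k v)) (g t)
      (ContMDiffAt.comp _ h2 h3) h1
  · change (extChartAt (𝓡∂ 2) t).symm (k ((𝓡∂ 2) (g t))) = t
    rw [hk0, hsymm]
  · have h1 := (continuousAt_extChartAt t).eventually hkl
    filter_upwards [h1, (extChartAt_source_mem_nhds t : (extChartAt (𝓡∂ 2) t).source ∈ 𝓝 t)] with w hw hw'
    have : f (extChartAt (𝓡∂ 2) t w) = (𝓡∂ 2) (g w) := by
      simp only [hfdef]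
      rw [(extChartAt (𝓡∂ 2) t).left_inv hw']
    rw [this] at hw
    change (extChartAt (𝓡∂ 2) t).symm (k ((𝓡∂ 2) (g w))) = w
    rw [hw, (extChartAt (𝓡∂ 2) t).left_inv hw']
  · filter_upwards [(𝓡∂ 2).continuousAt.eventually hkr] with u hu
    exact (𝓡∂ 2).injective hu

end Transversal

/-! ### Germs with values in a transverse surface -/

theorem eventually_iterate {X : Type*} [TopologicalSpace X] {f : X → X} {x : X}
    (hf : ContinuousAt f x) (hx : f x = x) {P : X → Prop} (hP : ∀ᶠ y in 𝓝 x, P y) (j : ℕ) :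
    ∀ᶠ y in 𝓝 x, P (f^[j] y) := by
  refine (ContinuousAt.iterate hf hx j).eventually ?_
  rwa [Function.iterate_fixed hx]

theorem eventually_forall_lt_iterate {X : Type*} [TopologicalSpace X] {f : X → X} {x : X}
    (hf : ContinuousAt f x) (hx : f x = x) {P : X → Prop} (hP : ∀ᶠ y in 𝓝 x, P y) (N : ℕ) :
    ∀ᶠ y in 𝓝 x, ∀ j < N, P (f^[j] y) := by
  have := (Finset.range N).eventually_all.mpr fun j _ => eventually_iterate hf hx hP j
  simpa using this

section TransversalTransport

variable {p : ℕ} {M : Type*} [TopologicalSpace M] [ChartedSpace (Model p) M]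
  {T : Set M} [ChartedSpace (EuclideanHalfSpace 2) T]

theorem inner_subset : inner T ⊆ T := by
  rintro _ ⟨t, -, rfl⟩; exact t.2

theorem mem_inner_of_notMem_bdry {z : M} (hz : z ∈ T) (h : z ∉ bdry T) : z ∈ inner T := by
  have : (⟨z, hz⟩ : T) ∈ (𝓡∂ 2).interior T ∪ (𝓡∂ 2).boundary T := by
    rw [ModelWithCorners.interior_union_boundary_eq_univ]; trivial
  rcases this with h' | h'
  · exact ⟨_, h', rfl⟩
  · exact absurd ⟨_, h', rfl⟩ h

omit [ChartedSpace (EuclideanHalfSpace 2) T] in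
theorem eventually_subtype {t : T} {P : T → Prop} (h : ∀ᶠ w in 𝓝 t, P w) :
    ∀ᶠ z in 𝓝 (t : M), ∀ hz : z ∈ T, P ⟨z, hz⟩ := by
  rw [nhds_subtype_eq_comap, eventually_comap] at h
  filter_upwards [h] with z hz hzT using hz ⟨z, hzT⟩ rfl

variable (p T) in
/-- A transport germ at `a` with values in the interior of `T`. -/
def IsTransportTo (φ : M → M) (a : M) : Prop :=
  IsTransport p φ a ∧ ∀ᶠ z in 𝓝 a, φ z ∈ inner T

variable [IsFoliated p M]

/-- The section of `exists_section` recovers a point of `T` from its transverse coordinate. -/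
theorem eventually_eq_of_transCoord_eq (hT : IsTransverseSurface p T) {t : M} (ht : t ∈ inner T) :
    ∀ᶠ q in 𝓝 (t, t), q.1 ∈ T → q.2 ∈ T → transCoord p t q.1 = transCoord p t q.2 → q.1 = q.2 := by
  obtain ⟨t, ht, rfl⟩ := ht
  obtain ⟨s, -, -, h, -⟩ := exists_section hT ht
  have h' := eventually_subtype h
  rw [nhds_prod_eq]
  filter_upwards [h'.prod_mk h'] with q hq h1 h2 heq
  have e1 := hq.1 h1
  have e2 := hq.2 h2
  have : (⟨q.1, h1⟩ : T) = ⟨q.2, h2⟩ := by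
    rw [← e1, ← e2]; exact congrArg s heq
  exact congrArg Subtype.val this

theorem contMDiffAt_leafCoord (m : M) :
    ContMDiffAt (corners p) (𝓡 p) 1 (fun z => (chartAt (Model p) m z).1) m := by
  have h1 : ContMDiffAt (corners p) (corners p) 1 (chartAt (Model p) m) m :=
    contMDiffAt_of_mem_maximalAtlas (IsManifold.subset_maximalAtlas (chart_mem_atlas _ m))
      (mem_chart_source _ m)
  have h2 : ContMDiffAt (corners p) (𝓡 p) 1 (fun z : Model p => z.1) (chartAt (Model p) m m) := by
    have h : ContMDiffAt ((𝓡 p).prod (𝓡∂ 2)) (𝓡 p) 1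
        (Prod.fst : EuclideanSpace ℝ (Fin p) × EuclideanHalfSpace 2 → _)
        (chartAt (Model p) m m) := contMDiffAt_fst
    rw [chartedSpaceSelf_prod] at h
    exact h
  exact h2.comp m h1

/-- The projection along plaques onto a transverse surface near an interior point. -/
theorem exists_retraction (hT : IsTransverseSurface p T) {t : M} (ht : t ∈ inner T) :
    ∃ r, IsTransportTo p T r t ∧ r t = t ∧ ∀ᶠ z in 𝓝 t, z ∈ T → r z = z := by
  obtain ⟨t, ht, rfl⟩ := ht
  obtain ⟨s, hs, hst, hsl, hsr⟩ := exists_section hT ht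
  set e := chartAt (Model p) (t : M)
  have hTm : IsManifold (𝓡∂ 2) 1 T := hT.1
  have hπ : ContinuousAt (transCoord p (t : M)) t := (contMDiffAt_transCoord (t : M)).continuousAt
  obtain ⟨B, hB, hBc, V, hV, hBV, h1, h2⟩ := exists_box p (t : M)
  have hsc : ContinuousAt s (transCoord p (t : M) t) := hs.continuousAt
  have hsM : ContMDiffAt (𝓡∂ 2) (corners p) 1 (fun u => (s u : M)) (transCoord p (t : M) t) :=
    ContMDiffAt.comp (g := (Subtype.val : T → M)) _ (hT.2.1 _) hs
  have hF : ContMDiffAt (𝓡∂ 2) (𝓡 p) 1 (fun u => (e (s u)).1) (e t).2 := by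
    have h3 := contMDiffAt_leafCoord (p := p) (t : M)
    refine ContMDiffAt.comp (g := fun z => (e z).1) (f := fun u => (s u : M)) _ ?_ hsM
    change ContMDiffAt _ _ 1 _ (s (transCoord p (t : M) t) : M)
    rw [hst]
    exact h3
  have hr := IsTransport.of_section (chart_mem_atlas _ (t : M)) (mem_chart_source _ (t : M)) hB hBc
    hV hBV h1 h2 hF (by
      change (e (s (transCoord p (t : M) t))).1 ∈ B
      rw [hst]; exact h1)
  have heq : (fun z => e.symm (((e (s (e z).2)).1, (e z).2) : Model p)) =ᶠ[𝓝 (t : M)]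
      fun z => (s (transCoord p (t : M) z) : M) := by
    have hsrc : ∀ᶠ u in 𝓝 (transCoord p (t : M) t), (s u : M) ∈ e.source := by
      refine hsM.continuousAt.eventually (e.open_source.mem_nhds ?_)
      change (s (transCoord p (t : M) t) : M) ∈ e.source
      rw [hst]; exact mem_chart_source _ _
    filter_upwards [hπ.eventually hsr, hπ.eventually hsrc] with z z1 z2
    have : e (s (transCoord p (t : M) z) : M) =
        (((e (s (transCoord p (t : M) z))).1, transCoord p (t : M) z) : Model p) :=
      Prod.ext rfl z1
    change e.symm (((e (s (transCoord p (t : M) z))).1, transCoord p (t : M) z) : Model p) = _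
    rw [← this, e.left_inv z2]
  refine ⟨_, ⟨hr.congr heq, ?_⟩, congrArg Subtype.val hst, ?_⟩
  · have ho : (𝓡∂ 2).interior T ∈ 𝓝 (s (transCoord p (t : M) t)) := by
      rw [hst]
      exact (ModelWithCorners.isOpen_interior (n := 1) (by simp)).mem_nhds ht
    filter_upwards [hπ.eventually (hsc.eventually ho)] with z hz using ⟨_, hz, rfl⟩
  · filter_upwards [eventually_subtype hsl] with z hz hzT
    exact congrArg Subtype.val (hz hzT)

namespace IsTransportTo

variable {φ χ ψ : M → M} {a b : M}

omit [IsFoliated p M] in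
theorem mem_inner (h : IsTransportTo p T φ a) : φ a ∈ inner T := h.2.self_of_nhds

omit [IsFoliated p M] in
theorem comp (hχ : IsTransportTo p T χ (φ a)) (hφ : IsTransport p φ a) :
    IsTransportTo p T (χ ∘ φ) a :=
  ⟨hχ.1.comp hφ, hφ.continuousAt.eventually hχ.2⟩

theorem eventually (h : IsTransportTo p T φ a) : ∀ᶠ z in 𝓝 a, IsTransportTo p T φ z :=
  h.1.eventually.and h.2.eventually_nhds

/-- A germ into `T` labels the plaques near `a`: transport is transversally injective, and
transverse coordinates separate the points of `T` near `φ a`. -/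
theorem eq_iff (hT : IsTransverseSurface p T) (h : IsTransportTo p T φ a) :
    ∀ᶠ q in 𝓝 (a, a), φ q.1 = φ q.2 ↔ transCoord p a q.1 = transCoord p a q.2 := by
  have h1 := (h.1.continuousAt.prodMap' h.1.continuousAt).eventually
    (eventually_eq_of_transCoord_eq hT h.mem_inner)
  have h2 : ∀ᶠ q in 𝓝 (a, a), φ q.1 ∈ T ∧ φ q.2 ∈ T := by
    have := h.2.mono fun z hz => inner_subset hz
    rw [nhds_prod_eq]
    exact this.prod_mk this
  filter_upwards [h1, h2, h.1.transverse] with q q1 q2 q3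
  rw [← q3]
  exact ⟨fun h => by rw [h], fun h => q1 q2.1 q2.2 h⟩

end IsTransportTo

theorem exists_isTransportTo (hT : IsTransverseSurface p T) {a t : M} (h : t ∈ leaf p a)
    (ht : t ∈ inner T) : ∃ φ, IsTransportTo p T φ a ∧ φ a = t := by
  obtain ⟨φ, hφ, rfl⟩ := exists_isTransport h
  obtain ⟨r, hr, hrt, -⟩ := exists_retraction hT ht
  exact ⟨r ∘ φ, hr.comp hφ, hrt⟩

/-- If the leaf holonomy preserves the orientation at `x`, then points of bounded period near `x`
of a holonomy germ are all fixed or all non-fixed. -/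
theorem IsTransportTo.eventually_fixed_or (hT : IsTransverseSurface p T) {x : T}
    (hor : ∀ ω : I → M, IsLeafLoop p (x : M) ω → ∀ h : T → T, IsHolonomy p T x ω h →
      PreservesOrientationAt T h x)
    {g : M → M} (hg : IsTransportTo p T g x) (hgx : g x = x) {N : ℕ} (hN : 0 < N)
    {F : Filter T} (hF : F ≤ 𝓝[≠] x) (hper : ∀ᶠ y : T in F, g^[N] y = y) :
    (∀ᶠ y : T in F, g y = y) ∨ ∀ᶠ y : T in F, g y ≠ y := by
  classical
  have hTm : IsManifold (𝓡∂ 2) 1 T := hT.1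
  have hxint : (𝓡∂ 2).IsInteriorPoint x := by
    obtain ⟨t, ht, htx⟩ := hg.mem_inner
    rw [hgx] at htx
    rwa [← Subtype.ext htx]
  let h : T → T := fun y => if hy : g y ∈ T then ⟨g y, hy⟩ else x
  have hval : ∀ᶠ y : T in 𝓝 x, (h y : M) = g y := by
    filter_upwards [continuous_subtype_val.continuousAt.eventually hg.2] with y hy
    simp [h, inner_subset hy]
  have hx : h x = x := Subtype.ext (hval.self_of_nhds.trans hgx)
  have hgc : ContinuousAt (fun y : T => g y) x :=
    ContinuousAt.comp (g := g) hg.1.continuousAt continuous_subtype_val.continuousAt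
  have hc : ContinuousAt h x := by
    rw [Topology.IsInducing.subtypeVal.continuousAt_iff]
    exact hgc.congr (hval.mono fun y hy => hy.symm)
  obtain ⟨s, hs, -, hsl, -⟩ := exists_section hT hxint
  have hsm : ContMDiffAt (𝓡∂ 2) (𝓡∂ 2) 1 h x := by
    have h1 : ContMDiffAt (𝓡∂ 2) (corners p) 1 (fun y : T => g y) x :=
      ContMDiffAt.comp (g := g) x hg.1.contMDiffAt (hT.2.1 x)
    have h2 : ContMDiffAt (corners p) (𝓡∂ 2) 1 (transCoord p (x : M)) (g x) := by
      rw [hgx]; exact contMDiffAt_transCoord _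
    have h3 : ContMDiffAt (𝓡∂ 2) (𝓡∂ 2) 1 s (transCoord p (x : M) (g x)) := by
      rw [hgx]; exact hs
    refine (ContMDiffAt.comp (g := s) x h3 (ContMDiffAt.comp (g := transCoord p (x : M)) x h2 h1)
      ).congr_of_eventuallyEq ?_
    have := hc.eventually (by rw [hx]; exact hsl)
    filter_upwards [hval, this] with y hy hy'
    simp only [Function.comp, ← hy, hy']
  obtain ⟨U, hU, Φ, hΦ, hΦl, hΦe⟩ := hg.1.exists_homotopy
  have hxU : (x : M) ∈ U := mem_of_mem_nhds hU
  -- The homotopy realising `g` traces a leaf loop at `x` and exhibits `h` as its holonomy.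
  have hpres := hor (fun s => Φ (x, s))
    ⟨hΦl x hxU, (hΦe x hxU).1, (hΦe x hxU).2.trans hgx⟩ h
    ⟨{y | (y : M) ∈ U ∧ (h y : M) = g y}, (continuous_subtype_val.continuousAt.eventually hU).and hval,
      fun q => Φ (q.1, q.2), hΦ.comp (by fun_prop) fun q hq => ⟨hq.1.1, hq.2⟩,
      fun y hy => hΦl y hy.1, fun y hy => ⟨(hΦe y hy.1).1, (hΦe y hy.1).2.trans hy.2.symm⟩,
      fun s => rfl⟩
  set c := extChartAt (𝓡∂ 2) x
  let f : EuclideanSpace ℝ (Fin 2) → EuclideanSpace ℝ (Fin 2) := fun v => c (h (c.symm v))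
  have hrange : range (𝓡∂ 2) ∈ 𝓝 (c x) := range_mem_nhds_isInteriorPoint hxint
  have hf : ContDiffAt ℝ 1 f (c x) := by
    have h := (contMDiffAt_iff.mp hsm).2.contDiffAt hrange
    rw [hx] at h
    exact h
  have hdf : LinearMap.det (fderiv ℝ f (c x)).toLinearMap =
      LinearMap.det (M := EuclideanSpace ℝ (Fin 2)) (mfderiv (𝓡∂ 2) (𝓡∂ 2) h x).toLinearMap := by
    have h1 : mfderiv (𝓡∂ 2) (𝓡∂ 2) h x = fderivWithin ℝ
      (writtenInExtChartAt (𝓡∂ 2) (𝓡∂ 2) x h) (range (𝓡∂ 2)) (c x) :=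
      if_pos (hsm.mdifferentiableAt (by simp))
    have h2 : writtenInExtChartAt (𝓡∂ 2) (𝓡∂ 2) x h = f := by
      simp only [writtenInExtChartAt, hx]; rfl
    rw [h1, h2, fderivWithin_of_mem_nhds hrange]
    rfl
  have hsrc : ∀ᶠ y in 𝓝 x, y ∈ c.source := extChartAt_source_mem_nhds x
  have hFx : F ≤ 𝓝 x := hF.trans nhdsWithin_le_nhds
  have hconj : ∀ y ∈ c.source, f (c y) = c (h y) := fun y hy => by
    simp only [f]; rw [c.left_inv hy]
  have hiter : ∀ᶠ y in F, f^[N] (c y) = c y := by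
    filter_upwards [hFx (eventually_forall_lt_iterate hc hx (hsrc.and hval) N), hper] with y hy hyN
    have : ∀ j ≤ N, f^[j] (c y) = c (h^[j] y) ∧ (h^[j] y : M) = g^[j] y := by
      intro j
      induction j with
      | zero => simp
      | succ j ih =>
        intro hj
        obtain ⟨h1, h2⟩ := ih (by omega)
        obtain ⟨h3, h4⟩ := hy j (by omega)
        simp only [Function.iterate_succ_apply', h1, ← h2, h4, hconj _ h3, and_self]
    obtain ⟨h1, h2⟩ := this N le_rfl
    rw [h1, show h^[N] y = y from Subtype.ext (h2.trans hyN)]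
  have hmap : map c F ≤ 𝓝[≠] (c x) := by
    refine tendsto_nhdsWithin_iff.mpr ⟨(continuousAt_extChartAt x).tendsto.mono_left hFx, ?_⟩
    have hne : ∀ᶠ y in F, y ≠ x := hF self_mem_nhdsWithin
    filter_upwards [hne, hFx hsrc] with y hy hy' heq
    exact hy (c.injOn hy' (mem_extChartAt_source x) heq)
  have hiff : ∀ᶠ y in F, f (c y) = c y ↔ g y = y := by
    filter_upwards [hFx hsrc, hFx hval, hFx (hc.eventually (by rw [hx]; exact hsrc))]
      with y y1 y2 y3
    rw [hconj y y1, ← y2]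
    exact ⟨fun h => congrArg Subtype.val (c.injOn y3 y1 h), fun h => congrArg c (Subtype.ext h)⟩
  rcases eventually_fixed_or_eventually_not_fixed (by simp) (hf.hasStrictFDerivAt (by simp))
    ((hconj x (mem_extChartAt_source x)).trans (by rw [hx])) (by rw [hdf]; exact hpres.2.2) hN hmap
    (eventually_map.mpr hiter) with h | h
  · left
    filter_upwards [hiff, eventually_map.mp h] with y h1 h2 using h1.mp h2
  · right
    filter_upwards [hiff, eventually_map.mp h] with y h1 h2 using fun h3 => h2 (h1.mpr h3)

end TransversalTransport

/-! ### Counting intersections near a compact leaf -/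

section Counting

variable {p : ℕ} {M : Type*} [TopologicalSpace M] [ChartedSpace (Model p) M] [IsFoliated p M]
  {T : Set M} [ChartedSpace (EuclideanHalfSpace 2) T]

namespace IsTransportTo

variable {φ χ ψ : M → M} {a t : M}

theorem eventually_injective (hT : IsTransverseSurface p T) (h : IsTransportTo p T φ a)
    (ha : a ∈ inner T) :
    ∀ᶠ q in 𝓝 (a, a), q.1 ∈ T → q.2 ∈ T → φ q.1 = φ q.2 → q.1 = q.2 := by
  filter_upwards [h.eq_iff hT, eventually_eq_of_transCoord_eq hT ha] with q h1 h2 h3 h4 h5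
  exact h2 h3 h4 (h1.mp h5)

theorem eventually_eq_of_leaf (hT : IsTransverseSurface p T) (h : IsTransportTo p T φ a) :
    ∀ᶠ z in @nhds M (leafTopology p M) a, φ z = φ a := by
  have h1 := ((by fun_prop : Continuous fun z : M => (z, a)).tendsto a).eventually (h.eq_iff hT)
  rw [nhds_leafTopology_chartAt, eventually_nhdsWithin_iff]
  filter_upwards [h1] with z hz hza using hz.mpr hza

omit [IsFoliated p M] in
theorem iterate_comp (hχ : IsTransportTo p T χ t) (ht : χ t = t) (hφ : IsTransport p φ a)
    (ha : φ a = t) (n : ℕ) : IsTransport p (χ^[n] ∘ φ) a := by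
  induction n with
  | zero => exact hφ
  | succ n ih =>
    rw [Function.iterate_succ', Function.comp_assoc]
    refine IsTransport.comp ?_ ih
    rw [Function.comp_apply, ha, Function.iterate_fixed ht]
    exact hχ.1

/-- Return germs are periodic, with a uniform period, on the leaves that meet `T` in a bounded
number of points. -/
theorem eventually_periodic (hT : IsTransverseSurface p T) (hχ : IsTransportTo p T χ t)
    (ht : χ t = t) (m : ℕ) :
    ∀ᶠ y in 𝓝 t, y ∈ T → (leaf p y ∩ T).encard ≤ m → χ^[m.factorial] y = y := by
  have htin : t ∈ inner T := ht ▸ hχ.mem_inner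
  have hinj := hχ.eventually_injective hT htin
  rw [nhds_prod_eq] at hinj
  obtain ⟨W, hW, hWs⟩ := mem_prod_self_iff.mp hinj
  filter_upwards [eventually_forall_lt_iterate hχ.1.continuousAt ht
    ((hχ.2.and hχ.1.eventually_mem_leaf).and hW) (m + 1)] with y hy hyT hcard
  have hmem : ∀ j ≤ m, χ^[j] y ∈ leaf p y ∩ T := by
    intro j
    induction j with
    | zero => exact fun _ => ⟨mem_leaf_self y, hyT⟩
    | succ j ih =>
      intro hj
      obtain ⟨⟨h1, h2⟩, -⟩ := hy j (by omega)
      rw [Function.iterate_succ_apply']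
      rw [leaf_eq_of_mem (ih (by omega)).1] at h2
      exact ⟨h2, inner_subset h1⟩
  -- Pigeonhole: the `m + 1` iterates from `χ^[0] y` to `χ^[m] y` lie in a set of at most `m`
  -- points.
  obtain ⟨i, j, hij, hjm, heq⟩ : ∃ i j, i < j ∧ j ≤ m ∧ χ^[i] y = χ^[j] y := by
    by_contra hcon
    push Not at hcon
    have hio : InjOn (fun j => χ^[j] y) (Finset.range (m + 1) : Set ℕ) := by
      intro i hi j hj hij
      simp only [Finset.coe_range, mem_Iio] at hi hj
      rcases lt_trichotomy i j with h | h | h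
      · exact absurd hij (hcon i j h (by omega))
      · exact h
      · exact absurd hij.symm (hcon j i h (by omega))
    have h1 := hio.encard_image
    have h2 : (fun j => χ^[j] y) '' (Finset.range (m + 1) : Set ℕ) ⊆ leaf p y ∩ T := by
      rintro _ ⟨j, hj, rfl⟩
      simp only [Finset.coe_range, mem_Iio] at hj
      exact hmem j (by omega)
    have h3 := (encard_le_encard h2).trans hcard
    rw [h1, encard_coe_eq_coe_finsetCard, Finset.card_range] at h3
    have : m + 1 ≤ m := by exact_mod_cast h3
    omega
  -- Local injectivity of `χ` on `T` strips off common iterates, leaving the period `j - i ≤ m`, a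
  -- divisor of `m!`.
  have hcancel : ∀ i, i ≤ m → ∀ k, i + k ≤ m → χ^[i] y = χ^[i + k] y → y = χ^[k] y := by
    intro i
    induction i with
    | zero => intro _ k _ h; simpa using h
    | succ i ih =>
      intro hi k hk h
      refine ih (by omega) k (by omega) ?_
      rw [show i + 1 + k = (i + k) + 1 by omega, Function.iterate_succ_apply',
        Function.iterate_succ_apply'] at h
      exact hWs (mk_mem_prod (hy i (by omega)).2 (hy (i + k) (by omega)).2) (hmem i (by omega)).2
        (hmem (i + k) (by omega)).2 h
  have hper := hcancel i (by omega) (j - i) (by omega) (by rw [heq]; congr 1; omega)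
  obtain ⟨l, hl⟩ := Nat.dvd_factorial (m := j - i) (n := m) (by omega) (by omega)
  rw [hl]
  exact (show Function.IsPeriodicPt χ (j - i) y from hper.symm).mul_const l

end IsTransportTo

section

variable {x : T} {F : Filter T} {m : ℕ}

omit [ChartedSpace (EuclideanHalfSpace 2) T] in
theorem tendsto_coe_of_le (hF : F ≤ 𝓝[≠] x) : Tendsto (fun y : T => (y : M)) F (𝓝 (x : M)) :=
  continuous_subtype_val.continuousAt.tendsto.mono_left (hF.trans nhdsWithin_le_nhds)

/-- On leaves with boundedly many points in `T`, germs into `T` can be lifted through each other. -/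
theorem exists_lift (hT : IsTransverseSurface p T) (hF : F ≤ 𝓝[≠] x)
    (hm : ∀ᶠ y : T in F, (leaf p (y : M) ∩ T).encard ≤ m) {z : M} {ψ g : M → M}
    (hψ : IsTransportTo p T ψ z) (hg : IsTransportTo p T g x) (hgx : g x = ψ z) :
    ∃ γ : M → M, IsTransport p γ x ∧ γ x = z ∧ ∀ᶠ y : T in F, ψ (γ y) = g y := by
  obtain ⟨τ, hτ, hτz⟩ : ∃ τ, IsTransport p τ (ψ z) ∧ τ (ψ z) = z := by
    refine exists_isTransport ?_
    rw [leaf_eq_of_mem hψ.1.mem_leaf]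
    exact mem_leaf_self z
  have hχ : IsTransportTo p T (ψ ∘ τ) (ψ z) :=
    IsTransportTo.comp (by rw [hτz]; exact hψ) hτ
  have hχt : (ψ ∘ τ) (ψ z) = ψ z := congrArg ψ hτz
  -- With `χ = ψ ∘ τ`, composing with `ψ` completes the exponent: `ψ ∘ γ = χ^[m!] ∘ g`, which equals
  -- `g` along `F` by periodicity.
  refine ⟨τ ∘ ((ψ ∘ τ)^[m.factorial - 1] ∘ g), ?_, ?_, ?_⟩
  · refine IsTransport.comp ?_ (hχ.iterate_comp hχt hg.1 hgx _)
    rw [Function.comp_apply, hgx, Function.iterate_fixed hχt]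
    exact hτ
  · change τ ((ψ ∘ τ)^[m.factorial - 1] (g x)) = z
    rw [hgx, Function.iterate_fixed hχt, hτz]
  · have h1 := hg.1.continuousAt.tendsto.comp (tendsto_coe_of_le hF)
    rw [hgx] at h1
    filter_upwards [h1.eventually (hχ.eventually_periodic hT hχt m), hm,
      (tendsto_coe_of_le hF).eventually hg.2,
      (tendsto_coe_of_le hF).eventually hg.1.eventually_mem_leaf] with y h2 h3 h4 h5
    have h6 := h2 (inner_subset h4) (by
      rw [Function.comp_apply, leaf_eq_of_mem h5]; exact h3)
    have h7 : m.factorial = m.factorial - 1 + 1 := by have := Nat.factorial_pos m; omega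
    rw [h7, Function.iterate_succ_apply'] at h6
    exact h6

/-- If `g x = g' x`, periodicity of a return germ `τ ∘ g'` yields a left inverse `κ` of `g'` along
`F`. Comparing `g` with `g'` then amounts to asking whether the return germ `κ ∘ g` fixes `y`, which
the orientation dichotomy settles. -/
theorem eventually_eq_or_ne [T2Space M] (hT : IsTransverseSurface p T)
    (hor : ∀ ω : I → M, IsLeafLoop p (x : M) ω → ∀ h : T → T, IsHolonomy p T x ω h →
      PreservesOrientationAt T h x) (hx : (x : M) ∈ inner T) (hF : F ≤ 𝓝[≠] x)
    (hm : ∀ᶠ y : T in F, (leaf p (y : M) ∩ T).encard ≤ m) {g g' : M → M}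
    (hg : IsTransportTo p T g x) (hg' : IsTransportTo p T g' x) :
    (∀ᶠ y : T in F, g y = g' y) ∨ ∀ᶠ y : T in F, g y ≠ g' y := by
  have hFx := tendsto_coe_of_le hF
  have hgt : Tendsto (fun y : T => (g y, g' y)) F (𝓝 (g x, g' x)) :=
    (hg.1.continuousAt.tendsto.comp hFx).prodMk_nhds (hg'.1.continuousAt.tendsto.comp hFx)
  by_cases hxx : g x = g' x
  swap
  · right
    exact hgt.eventually ((isOpen_ne_fun continuous_fst continuous_snd).mem_nhds hxx)
  obtain ⟨τ, hτ, hτx⟩ : ∃ τ, IsTransportTo p T τ (g' x) ∧ τ (g' x) = x := by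
    refine exists_isTransportTo hT ?_ hx
    rw [leaf_eq_of_mem hg'.1.mem_leaf]
    exact mem_leaf_self _
  have hχ : IsTransportTo p T (τ ∘ g') x := hτ.comp hg'.1
  have hκ : ∀ n, IsTransportTo p T ((τ ∘ g')^[n] ∘ τ) (g' x) := by
    intro n
    refine ⟨hχ.iterate_comp hτx hτ.1 hτx n, ?_⟩
    induction n with
    | zero => exact hτ.2
    | succ n ih =>
      have h1 := (hχ.iterate_comp hτx hτ.1 hτx n).continuousAt
      have h2 : ((τ ∘ g')^[n] ∘ τ) (g' x) = x := by
        rw [Function.comp_apply, hτx]; exact Function.iterate_fixed hτx n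
      have h3 := h1.eventually (by rw [h2]; exact hχ.2)
      filter_upwards [h3] with z hz
      rw [Function.iterate_succ']
      exact hz
  set κ := (τ ∘ g')^[m.factorial - 1] ∘ τ with hκdef
  have hκx : κ (g' x) = x := by
    rw [hκdef, Function.comp_apply, hτx]; exact Function.iterate_fixed hτx _
  have hκg' : ∀ᶠ y : T in F, κ (g' y) = y := by
    filter_upwards [hFx.eventually (hχ.eventually_periodic hT hτx m), hm] with y h1 h2
    have h3 := h1 y.2 h2
    have h7 : m.factorial = m.factorial - 1 + 1 := by have := Nat.factorial_pos m; omega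
    rw [h7, Function.iterate_succ_apply] at h3
    exact h3
  have hh : IsTransportTo p T (κ ∘ g) x := IsTransportTo.comp (by rw [hxx]; exact hκ _) hg.1
  have hhx : (κ ∘ g) x = x := by rw [Function.comp_apply, hxx, hκx]
  have hper : ∀ᶠ y : T in F, (κ ∘ g)^[m.factorial] y = y := by
    filter_upwards [hFx.eventually (hh.eventually_periodic hT hhx m), hm] with y h1 h2
    exact h1 y.2 h2
  rcases hh.eventually_fixed_or hT hor hhx (Nat.factorial_pos m) hF hper with h | h
  · left
    rw [hxx] at hgt
    filter_upwards [h, hκg', hgt.eventually ((hκ _).eventually_injective hT hg'.mem_inner),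
      hFx.eventually hg.2, hFx.eventually hg'.2] with y h1 h2 h3 h4 h5
    exact h3 (inner_subset h4) (inner_subset h5) (h1.trans h2.symm)
  · right
    filter_upwards [h, hκg'] with y h1 h2 h3
    exact h1 (by rw [Function.comp_apply, h3, h2])

/-- A finite complete list of the germs into `T`, up to eventual equality on bounded leaves. -/
theorem exists_complete_transports [T2Space M] [F.NeBot] (hT : IsTransverseSurface p T)
    (hor : ∀ ω : I → M, IsLeafLoop p (x : M) ω → ∀ h : T → T, IsHolonomy p T x ω h →
      PreservesOrientationAt T h x) (hx : (x : M) ∈ inner T) (hF : F ≤ 𝓝[≠] x)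
    (hm : ∀ᶠ y : T in F, (leaf p (y : M) ∩ T).encard ≤ m) :
    ∃ G : Finset (M → M), (∀ g ∈ G, IsTransportTo p T g x) ∧
      (∀ᶠ y : T in F, InjOn (fun g : M → M => g y) G) ∧
      ∀ g, IsTransportTo p T g x → ∃ g' ∈ G, ∀ᶠ y : T in F, g y = g' y := by
  classical
  by_contra hcon
  push Not at hcon
  have hFx := tendsto_coe_of_le hF
  -- Were no finite list complete, lists of every length with distinct values would exist; length `m
  -- + 1` exceeds the bound on the leaves.
  have key : ∀ n : ℕ, ∃ G : Finset (M → M), G.card = n ∧ (∀ g ∈ G, IsTransportTo p T g x) ∧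
      ∀ᶠ y : T in F, InjOn (fun g : M → M => g y) G := by
    intro n
    induction n with
    | zero => exact ⟨∅, rfl, by simp, by simp⟩
    | succ n ih =>
      obtain ⟨G, hGn, hG, hGi⟩ := ih
      obtain ⟨g, hg, hgG⟩ := hcon G hG hGi
      have hne : ∀ g' ∈ G, ∀ᶠ y : T in F, g y ≠ g' y := fun g' hg' =>
        (eventually_eq_or_ne hT hor hx hF hm hg (hG g' hg')).resolve_left
          fun h => hgG g' hg' (h.mono fun y hy hne => hne hy)
      have hgG' : g ∉ G := fun h => by
        obtain ⟨y, hy⟩ := (hne g h).exists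
        exact hy rfl
      refine ⟨insert g G, by rw [Finset.card_insert_of_notMem hgG', hGn], ?_, ?_⟩
      · intro g' hg'
        rcases Finset.mem_insert.mp hg' with rfl | h
        · exact hg
        · exact hG g' h
      · filter_upwards [hGi, G.eventually_all.mpr hne] with y h1 h2
        rw [Finset.coe_insert, injOn_insert (by exact_mod_cast hgG')]
        refine ⟨h1, ?_⟩
        rintro ⟨g', hg', h⟩
        exact h2 g' hg' h.symm
  obtain ⟨G, hGn, hG, hGi⟩ := key (m + 1)
  have hGm : ∀ᶠ y : T in F, ∀ g ∈ G, g y ∈ leaf p (y : M) ∩ T := G.eventually_all.mpr fun g hg =>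
    ((hFx.eventually (hG g hg).1.eventually_mem_leaf).and (hFx.eventually (hG g hg).2)).mono
      fun y hy => ⟨hy.1, inner_subset hy.2⟩
  obtain ⟨y, h1, h2, h3⟩ := (hm.and (hGi.and hGm)).exists
  have h4 : (fun g : M → M => g y) '' G ⊆ leaf p (y : M) ∩ T := by
    rintro _ ⟨g, hg, rfl⟩; exact h3 g hg
  have h5 := (encard_le_encard h4).trans h1
  rw [h2.encard_image, encard_coe_eq_coe_finsetCard, hGn] at h5
  have : m + 1 ≤ m := by exact_mod_cast h5
  omega

variable {G : Finset (M → M)}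

/-- If `ψ z' = g y`, lift `g` through `ψ` to `γ`. Then `z'` and `γ y` lie in one plaque, so `θ z' =
θ (γ y)`, and `θ ∘ γ` is a germ represented in `G`. -/
theorem eventually_mem_image [T2Space M] (hT : IsTransverseSurface p T) (hF : F ≤ 𝓝[≠] x)
    (hm : ∀ᶠ y : T in F, (leaf p (y : M) ∩ T).encard ≤ m)
    (hG : ∀ g ∈ G, IsTransportTo p T g x)
    (hGc : ∀ g, IsTransportTo p T g x → ∃ g' ∈ G, ∀ᶠ y : T in F, g y = g' y)
    {z : M} {ψ θ : M → M} (hψ : IsTransportTo p T ψ z) (hθ : IsTransportTo p T θ z) :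
    ∀ᶠ q in 𝓝 z ×ˢ F, ψ q.1 ∈ (fun g : M → M => g (q.2 : M)) '' G →
      θ q.1 ∈ (fun g : M → M => g (q.2 : M)) '' G := by
  have hFx := tendsto_coe_of_le hF
  have key : ∀ g ∈ G, ∀ᶠ q in 𝓝 z ×ˢ F, g (q.2 : M) = ψ q.1 →
      θ q.1 ∈ (fun g : M → M => g (q.2 : M)) '' G := by
    intro g hg
    have hψt : Tendsto (fun q : M × T => ψ q.1) (𝓝 z ×ˢ F) (𝓝 (ψ z)) :=
      hψ.1.continuousAt.tendsto.comp tendsto_fst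
    by_cases hgx : g x = ψ z
    · obtain ⟨γ, hγ, hγx, hγy⟩ := exists_lift hT hF hm hψ (hG g hg) hgx
      obtain ⟨g', hg', hgg'⟩ := hGc (θ ∘ γ) (IsTransportTo.comp (by rw [hγx]; exact hθ) hγ)
      have hγt : Tendsto (fun q : M × T => γ (q.2 : M)) (𝓝 z ×ˢ F) (𝓝 z) := by
        have := hγ.continuousAt.tendsto.comp (hFx.comp (tendsto_snd (f := 𝓝 z)))
        rwa [hγx] at this
      have ht : Tendsto (fun q : M × T => (q.1, γ (q.2 : M))) (𝓝 z ×ˢ F) (𝓝 (z, z)) :=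
        tendsto_fst.prodMk_nhds hγt
      filter_upwards [ht.eventually (hψ.eq_iff hT), ht.eventually (hθ.eq_iff hT),
        tendsto_snd.eventually hγy, tendsto_snd.eventually hgg'] with q h1 h2 h3 h4 h5
      refine ⟨g', hg', ?_⟩
      simp only [Function.comp_apply] at h4
      change g' (q.2 : M) = θ q.1
      rw [← h4]
      exact (h2.mpr (h1.mp (h5.symm.trans h3.symm))).symm
    · have hgt : Tendsto (fun q : M × T => (g (q.2 : M), ψ q.1)) (𝓝 z ×ˢ F) (𝓝 (g x, ψ z)) :=
        ((hG g hg).1.continuousAt.tendsto.comp (hFx.comp tendsto_snd)).prodMk_nhds hψt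
      filter_upwards [hgt.eventually ((isOpen_ne_fun continuous_fst continuous_snd).mem_nhds hgx)]
        with q h1 h2 using absurd h2 h1
  filter_upwards [G.eventually_all.mpr key] with q hq
  rintro ⟨g, hg, h⟩
  exact hq g hg h

/-- All germs move points inside leaves, so `g x` and `ψ z` lie in different leaves; Hausdorff
separation does the rest. -/
theorem eventually_notMem_image [T2Space M] (hF : F ≤ 𝓝[≠] x)
    (hG : ∀ g ∈ G, IsTransportTo p T g x) {z : M} (hz : z ∉ leaf p (x : M))
    {ψ : M → M} (hψ : IsTransportTo p T ψ z) :
    ∀ᶠ q in 𝓝 z ×ˢ F, ψ q.1 ∉ (fun g : M → M => g (q.2 : M)) '' G := by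
  have hFx := tendsto_coe_of_le hF
  have hψt : Tendsto (fun q : M × T => ψ q.1) (𝓝 z ×ˢ F) (𝓝 (ψ z)) :=
    hψ.1.continuousAt.tendsto.comp tendsto_fst
  have key : ∀ g ∈ G, ∀ᶠ q in 𝓝 z ×ˢ F, g (q.2 : M) ≠ ψ q.1 := by
    intro g hg
    have hgx : g x ≠ ψ z := fun h => hz <| by
      rw [← leaf_eq_of_mem (hG g hg).1.mem_leaf, h, leaf_eq_of_mem hψ.1.mem_leaf]
      exact mem_leaf_self z
    have hgt : Tendsto (fun q : M × T => (g (q.2 : M), ψ q.1)) (𝓝 z ×ˢ F) (𝓝 (g x, ψ z)) :=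
      ((hG g hg).1.continuousAt.tendsto.comp (hFx.comp tendsto_snd)).prodMk_nhds hψt
    exact hgt.eventually ((isOpen_ne_fun continuous_fst continuous_snd).mem_nhds hgx)
  filter_upwards [G.eventually_all.mpr key] with q hq
  rintro ⟨g, hg, h⟩
  exact hq g hg h

omit [ChartedSpace (Model p) M] [IsFoliated p M] [ChartedSpace (EuclideanHalfSpace 2) T] in
theorem eventually_forall_mem_compact {K : Set M} (hK : IsCompact K) {P : M → T → Prop}
    (h : ∀ z ∈ K, ∀ᶠ q in 𝓝 z ×ˢ F, P q.1 q.2) : ∀ᶠ y in F, ∀ z ∈ K, P z y := by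
  have h1 := hK.mem_nhdsSet_prod_of_forall (l := F) (s := {q | P q.1 q.2}) h
  obtain ⟨A, hA, B, hB, hAB⟩ := mem_prod_iff.mp h1
  filter_upwards [hB] with y hy z hz
  exact hAB (mk_mem_prod (subset_of_mem_nhdsSet hA hz) hy)

/-- Near a compact leaf, the leaves with boundedly many points in `T` all have the same number
of points in `T`. -/
theorem exists_eventually_encard_eq [T2Space M] (hT : IsTransverseSurface p T) (hTc : IsClosed T)
    (hL : IsCompactLeaf p (leaf p (x : M))) (hLT : leaf p (x : M) ∩ T ⊆ inner T)
    (hor : ∀ ω : I → M, IsLeafLoop p (x : M) ω → ∀ h : T → T, IsHolonomy p T x ω h →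
      PreservesOrientationAt T h x) (hF : F ≤ 𝓝[≠] x)
    (hm : ∀ᶠ y : T in F, (leaf p (y : M) ∩ T).encard ≤ m) :
    ∃ c : ℕ, ∀ᶠ y : T in F, (leaf p (y : M) ∩ T).encard = c := by
  rcases F.eq_or_neBot with rfl | hFn
  · exact ⟨0, by simp⟩
  have hFx := tendsto_coe_of_le hF
  have hxin : (x : M) ∈ inner T := hLT ⟨mem_leaf_self _, x.2⟩
  obtain ⟨G, hG, hGi, hGc⟩ := exists_complete_transports hT hor hxin hF hm
  let Q : T → Set M := fun y => (fun g : M → M => g (y : M)) '' G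
  have : LocallyCompactSpace M := Manifold.locallyCompact_of_finiteDimensional (corners p)
  have hloc : ∀ a ∈ leaf p (x : M), ∃ ψ : M → M, ∃ K : Set M, IsCompact K ∧ K ∈ 𝓝 a ∧
      ∀ z ∈ K, IsTransportTo p T ψ z := by
    intro a ha
    obtain ⟨ψ, hψ, -⟩ := exists_isTransportTo hT (a := a) (t := x)
      (by rw [leaf_eq_of_mem ha]; exact mem_leaf_self _) hxin
    obtain ⟨K, hK, hKs, hKc⟩ := local_compact_nhds hψ.eventually
    exact ⟨ψ, K, hKc, hK, hKs⟩
  choose! ψ K hKc hKn hKψ using hloc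
  obtain ⟨s, hsL, hs⟩ := hL.isCompact.elim_nhds_subcover (fun a => interior (K a))
    (fun a ha => interior_mem_nhds.mpr (hKn a ha))
  have hcov : ∀ z ∈ leaf p (x : M), ∃ b ∈ s, z ∈ interior (K b) := fun z hz => by
    simpa using hs hz
  -- This transition from `K a` to the interior of some `K b` is what makes `A` below closed in the
  -- leaf topology.
  have h1 : ∀ᶠ y in F, ∀ a ∈ s, ∀ z ∈ K a, ψ a z ∈ Q y →
      ∃ b ∈ s, z ∈ interior (K b) ∧ ψ b z ∈ Q y := by
    refine s.eventually_all.mpr fun a ha => eventually_forall_mem_compact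
      (P := fun z y => ψ a z ∈ Q y → ∃ b ∈ s, z ∈ interior (K b) ∧ ψ b z ∈ Q y)
      (hKc a (hsL a ha)) fun z hz => ?_
    have hψz := hKψ a (hsL a ha) z hz
    by_cases hzL : z ∈ leaf p (x : M)
    · obtain ⟨b, hb, hzb⟩ := hcov z hzL
      have hψb := hKψ b (hsL b hb) z (interior_subset hzb)
      filter_upwards [eventually_mem_image hT hF hm hG hGc hψz hψb,
        tendsto_fst.eventually (isOpen_interior.mem_nhds hzb)] with q q1 q2 q3
      exact ⟨b, hb, q2, q1 q3⟩
    · filter_upwards [eventually_notMem_image hF hG hzL hψz] with q q1 q2 using absurd q2 q1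
  -- At points of `T` the label `ψ a` is exchanged for the retraction, which fixes them, so the
  -- points themselves belong to `Q y`.
  have h2 : ∀ᶠ y in F, ∀ a ∈ s, ∀ z ∈ K a ∩ T, z ∈ T → ψ a z ∈ Q y → z ∈ Q y := by
    refine s.eventually_all.mpr fun a ha => eventually_forall_mem_compact
      (P := fun z y => z ∈ T → ψ a z ∈ Q y → z ∈ Q y)
      ((hKc a (hsL a ha)).inter_right hTc) fun z hz => ?_
    have hψz := hKψ a (hsL a ha) z hz.1
    by_cases hzL : z ∈ leaf p (x : M)
    · obtain ⟨r, hr, -, hrT⟩ := exists_retraction hT (hLT ⟨hzL, hz.2⟩)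
      filter_upwards [eventually_mem_image hT hF hm hG hGc hψz hr, tendsto_fst.eventually hrT]
        with q q1 q2 q3 q4
      have := q1 q4
      rwa [q2 q3] at this
    · filter_upwards [eventually_notMem_image hF hG hzL hψz] with q q1 q2 q3 using absurd q3 q1
  have h3 : ∀ᶠ y : T in F, ∃ b ∈ s, (y : M) ∈ interior (K b) ∧ ψ b y ∈ Q y := by
    obtain ⟨b, hb, hxb⟩ := hcov x (mem_leaf_self _)
    obtain ⟨g, hg, hgb⟩ := hGc (ψ b) (hKψ b (hsL b hb) x (interior_subset hxb))
    filter_upwards [hgb, hFx.eventually (isOpen_interior.mem_nhds hxb)] with y y1 y2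
    exact ⟨b, hb, y2, g, hg, y1.symm⟩
  have h4 : ∀ᶠ y : T in F, ∀ g ∈ G, g y ∈ leaf p (y : M) ∩ T := G.eventually_all.mpr fun g hg =>
    ((hFx.eventually (hG g hg).1.eventually_mem_leaf).and (hFx.eventually (hG g hg).2)).mono
      fun y hy => ⟨hy.1, inner_subset hy.2⟩
  refine ⟨G.card, ?_⟩
  filter_upwards [h1, h2, h3, h4, hGi] with y y1 y2 y3 y4 y5
  -- `A` traps the leaf of `y` near the compact leaf: it is clopen in the leaf topology and contains
  -- `y`.
  let A : Set M := {z | ∃ b ∈ s, z ∈ interior (K b) ∧ ψ b z ∈ Q y}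
  have hle : ∀ z : M, @nhds M (leafTopology p M) z ≤ 𝓝 z := fun z =>
    nhds_mono (leafTopology_le p M)
  have hconst : ∀ b ∈ s, ∀ z ∈ K b, ∀ᶠ w in @nhds M (leafTopology p M) z, ψ b w = ψ b z :=
    fun b hb z hz => (hKψ b (hsL b hb) z hz).eventually_eq_of_leaf hT
  have hA : @IsClopen M (leafTopology p M) A := by
    constructor
    · refine (@isOpen_compl_iff M A (leafTopology p M)).mp ?_
      refine (@isOpen_iff_mem_nhds M (leafTopology p M) _).mpr fun z hz => ?_
      have : ∀ b ∈ s, ∀ᶠ w in @nhds M (leafTopology p M) z,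
          ¬ (w ∈ interior (K b) ∧ ψ b w ∈ Q y) := by
        intro b hb
        by_cases hzb : z ∈ K b
        · filter_upwards [hconst b hb z hzb] with w hw hw'
          rw [hw] at hw'
          exact hz (y1 b hb z hzb hw'.2)
        · filter_upwards [hle z ((hKc b (hsL b hb)).isClosed.isOpen_compl.mem_nhds hzb)]
            with w hw hw'
          exact hw (interior_subset hw'.1)
      filter_upwards [s.eventually_all.mpr this] with w hw
      rintro ⟨b, hb, hw'⟩
      exact hw b hb hw'
    · refine (@isOpen_iff_mem_nhds M (leafTopology p M) _).mpr ?_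
      rintro z ⟨b, hb, hzb, hzQ⟩
      filter_upwards [hconst b hb z (interior_subset hzb),
        hle z (isOpen_interior.mem_nhds hzb)] with w hw hw'
      exact ⟨b, hb, hw', by rw [hw]; exact hzQ⟩
  have hsub : leaf p (y : M) ⊆ A :=
    @IsClopen.connectedComponent_subset M (leafTopology p M) A y hA y3
  have heq : leaf p (y : M) ∩ T = Q y := by
    apply Subset.antisymm
    · rintro z ⟨hz, hzT⟩
      obtain ⟨b, hb, hzb, hzQ⟩ := hsub hz
      exact y2 b hb z ⟨interior_subset hzb, hzT⟩ hzT hzQ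
    · rintro _ ⟨g, hg, rfl⟩
      exact y4 g hg
  rw [heq, y5.encard_image, encard_coe_eq_coe_finsetCard]

end

end Counting

/-! ### Finiteness and lower semicontinuity -/

section Semicontinuity

variable {p : ℕ} {M : Type*} [TopologicalSpace M] [ChartedSpace (Model p) M] [IsFoliated p M]
  {T : Set M} [ChartedSpace (EuclideanHalfSpace 2) T]

/-- In the leaf topology the intersection is compact, and it is discrete because transverse
coordinates separate nearby points of `T`. -/
theorem finite_leaf_inter (hT : IsTransverseSurface p T) (hTc : IsClosed T) {y : M}
    (hL : IsCompactLeaf p (leaf p y)) (hLT : leaf p y ∩ T ⊆ inner T) :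
    (leaf p y ∩ T).Finite := by
  have hcomp : @IsCompact M (leafTopology p M) (leaf p y ∩ T) :=
    @IsCompact.inter_right M (leafTopology p M) _ _ hL
      (IsClosed.mono hTc (leafTopology_le p M))
  obtain ⟨s, -, hs⟩ := @IsCompact.elim_nhds_subcover M (leafTopology p M) _ hcomp
    (fun t => {w | w ∈ T → w = t}) (fun t ht => by
      have h1 := ((by fun_prop : Continuous fun z : M => (z, t)).tendsto t).eventually
        (eventually_eq_of_transCoord_eq hT (hLT ht))
      rw [nhds_leafTopology_chartAt, mem_nhdsWithin_iff_eventually]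
      filter_upwards [h1] with w hw hwt hwT using hw hwT ht.2 hwt)
  refine s.finite_toSet.subset fun w hw => ?_
  obtain ⟨t, ht, hwt⟩ := mem_iUnion₂.mp (hs hw)
  rw [show w = t from hwt hw.2]
  exact ht

/-- The number of intersection points with the interior of `T` is lower semicontinuous. -/
theorem eventually_lt_encard [T2Space M] (hT : IsTransverseSurface p T) {y : M} {k : ℕ}
    (hk : (k : ℕ∞) < (leaf p y ∩ inner T).encard) :
    ∀ᶠ z in 𝓝 y, (k : ℕ∞) < (leaf p z ∩ T).encard := by
  obtain ⟨s, hsub, hcard⟩ := exists_subset_encard_eq (Order.add_one_le_of_lt hk)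
  have hfin : s.Finite := finite_of_encard_eq_coe (k := k + 1) (by rw [hcard]; norm_cast)
  have hex : ∀ t ∈ s, ∃ g, IsTransportTo p T g y ∧ g y = t := fun t ht =>
    exists_isTransportTo hT (hsub ht).1 (hsub ht).2
  choose! g hg hgt using hex
  have h1 : ∀ᶠ z in 𝓝 y, ∀ t ∈ s, g t z ∈ leaf p z ∩ T := hfin.eventually_all.mpr fun t ht =>
    ((hg t ht).1.eventually_mem_leaf.and (hg t ht).2).mono
      fun z hz => ⟨hz.1, inner_subset hz.2⟩
  have h2 : ∀ᶠ z in 𝓝 y, ∀ t ∈ s, ∀ t' ∈ s, t ≠ t' → g t z ≠ g t' z := by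
    refine hfin.eventually_all.mpr fun t ht => hfin.eventually_all.mpr fun t' ht' => ?_
    by_cases htt : t = t'
    · exact Eventually.of_forall fun z h => absurd htt h
    · have hc : Tendsto (fun z => (g t z, g t' z)) (𝓝 y) (𝓝 (t, t')) := by
        have := ((hg t ht).1.continuousAt.prodMk (hg t' ht').1.continuousAt).tendsto
        rwa [hgt t ht, hgt t' ht'] at this
      exact (hc.eventually ((isOpen_ne_fun continuous_fst continuous_snd).mem_nhds htt)).mono
        fun z hz _ => hz
  filter_upwards [h1, h2] with z hz1 hz2
  have hinj : InjOn (fun t => g t z) s := fun t ht t' ht' h => by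
    by_contra hne
    exact hz2 t ht t' ht' hne h
  have hle : (fun t => g t z) '' s ⊆ leaf p z ∩ T := by
    rintro _ ⟨t, ht, rfl⟩; exact hz1 t ht
  have := encard_le_encard hle
  rw [hinj.encard_image, hcard] at this
  exact lt_of_lt_of_le (by exact_mod_cast Nat.lt_succ_self k) this

end Semicontinuity

end Foliation

/-! ### Conclusion on the continuum `C` -/

open Filter Set in
theorem proposition4p1 (p : ℕ) {M : Type*} [TopologicalSpace M] [T2Space M]
    [SecondCountableTopology M] [ChartedSpace (Foliation.Model p) M] [Foliation.IsFoliated p M]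
    (T : Set M) [ChartedSpace (EuclideanHalfSpace 2) T]
    (hT : Foliation.IsTransverseManifold p T) (hTclosed : IsClosed T)
    (C : Set M) (hCT : C ⊆ T) (hCcompact : IsCompact C) (hCconn : IsConnected C)
    (h_i : ∀ x ∈ C, Foliation.IsCompactLeaf p (Foliation.leaf p x) →
      Disjoint (Foliation.leaf p x) (Foliation.bdry T))
    (h_ii : ∀ x ∈ C, ¬ Foliation.IsCompactLeaf p (Foliation.leaf p x) →
      (Foliation.leaf p x ∩ Foliation.inner T).Infinite)
    (h_iii : ∀ x : T, (x : M) ∈ C → Foliation.IsCompactLeaf p (Foliation.leaf p (x : M)) →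
      ∀ ω : unitInterval → M, Foliation.IsLeafLoop p (x : M) ω →
      ∀ h : T → T, Foliation.IsHolonomy p T x ω h → Foliation.PreservesOrientationAt T h x)
    (h_iv : ∃ E : ℕ → Set M, (∀ j, IsClosed (E j)) ∧ Pairwise (fun i j => Disjoint (E i) (E j)) ∧
      ⋃ j, E j = {x ∈ C | ¬ Foliation.IsCompactLeaf p (Foliation.leaf p x)}) :
    (∀ L ∈ Foliation.leaf p '' C, ¬ Foliation.IsCompactLeaf p L) ∨
    ∃ ρ : ℕ, {L ∈ Foliation.leaf p '' C | (L ∩ T).encard ≠ ρ}.Finite ∧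
      ∀ L ∈ Foliation.leaf p '' C, (L ∩ T).encard ≠ ρ → (L ∩ T).encard < ρ := by
  have : CompactSpace C := isCompact_iff_compactSpace.mp hCcompact
  have : ConnectedSpace C := Subtype.connectedSpace hCconn
  have hLT : ∀ x ∈ C, Foliation.IsCompactLeaf p (Foliation.leaf p x) →
      Foliation.leaf p x ∩ T ⊆ Foliation.inner T := fun x hx hL z hz =>
    Foliation.mem_inner_of_notMem_bdry hz.2 fun hb => (h_i x hx hL).le_bot ⟨hz.1, hb⟩
  let n : C → ℕ∞ := fun x => (Foliation.leaf p (x : M) ∩ T).encard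
  have htop : ∀ x : C, n x = ⊤ ↔ ¬ Foliation.IsCompactLeaf p (Foliation.leaf p (x : M)) := by
    intro x
    constructor
    · intro h hL
      exact (encard_eq_top_iff.mp h)
        (Foliation.finite_leaf_inter hT.1 hTclosed hL (hLT x x.2 hL))
    · intro hL
      exact encard_eq_top_iff.mpr
        ((h_ii x x.2 hL).mono (inter_subset_inter_right _ Foliation.inner_subset))
  have hclosed : ∀ k : ℕ, IsClosed {x | n x ≤ k} := by
    intro k
    rw [← isOpen_compl_iff, isOpen_iff_mem_nhds]
    intro x hx
    -- Semicontinuity needs interior intersections: on compact leaves (i) makes all of them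
    -- interior, on the others (ii) gives infinitely many.
    have hx' : (k : ℕ∞) < (Foliation.leaf p (x : M) ∩ Foliation.inner T).encard := by
      by_cases hL : Foliation.IsCompactLeaf p (Foliation.leaf p (x : M))
      · have : Foliation.leaf p (x : M) ∩ Foliation.inner T = Foliation.leaf p (x : M) ∩ T :=
          Subset.antisymm (inter_subset_inter_right _ Foliation.inner_subset)
            fun z hz => ⟨hz.1, hLT x x.2 hL hz⟩
        rw [this]
        exact not_le.mp hx
      · rw [(h_ii x x.2 hL).encard_eq]
        exact ENat.natCast_lt_top k
    filter_upwards [continuous_subtype_val.continuousAt.eventually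
      (Foliation.eventually_lt_encard hT.1 hx')] with z hz
    exact not_le.mpr hz
  have hconst : ∀ x, n x ≠ ⊤ → ∀ m : ℕ, ∃ c : ℕ, ∀ᶠ y in 𝓝[≠] x, n y ≤ m → n y = c := by
    intro x hx m
    have hL : Foliation.IsCompactLeaf p (Foliation.leaf p (x : M)) := by
      by_contra hL
      exact hx ((htop x).mpr hL)
    -- Approach to `x` inside `T` through the points of `C` other than `x` whose leaves meet `T` at
    -- most `m` times.
    let F : Filter T := map (inclusion hCT) (𝓝[≠] x ⊓ 𝓟 {y | n y ≤ m})
    have hF : F ≤ 𝓝[≠] (inclusion hCT x) := by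
      refine (tendsto_nhdsWithin_iff.mpr ⟨?_, ?_⟩ :
        Tendsto (inclusion hCT) (𝓝[≠] x ⊓ 𝓟 {y | n y ≤ m}) (𝓝[≠] (inclusion hCT x)))
      · exact (continuous_inclusion hCT).continuousAt.tendsto.mono_left
          (inf_le_left.trans nhdsWithin_le_nhds)
      · have : ∀ᶠ y in 𝓝[≠] x ⊓ 𝓟 {y | n y ≤ m}, y ≠ x :=
          (inf_le_left : _ ≤ 𝓝[≠] x) self_mem_nhdsWithin
        filter_upwards [this] with y hy h using hy (inclusion_injective hCT h)
    obtain ⟨c, hc⟩ := Foliation.exists_eventually_encard_eq (m := m) hT.1 hTclosed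
      (x := inclusion hCT x) hL (hLT x x.2 hL) (h_iii (inclusion hCT x) x.2 hL) hF
      (eventually_map.mpr (mem_inf_of_right (mem_principal_self _)))
    refine ⟨c, ?_⟩
    exact eventually_inf_principal.mp (eventually_map.mp hc)
  obtain ⟨E, hE, hEd, hEu⟩ := h_iv
  have hmemE : ∀ x : C, (x : M) ∈ ⋃ j, E j ↔ n x = ⊤ := fun x => by
    rw [hEu, htop]; exact ⟨fun h => h.2, fun h => ⟨x.2, h⟩⟩
  rcases Foliation.eq_top_or_almost_constant n hclosed hconst (fun j => Subtype.val ⁻¹' E j)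
    (fun j => (hE j).preimage continuous_subtype_val)
    (fun i j hij => (hEd hij).preimage _)
    (by ext x; rw [← preimage_iUnion]; exact hmemE x) with h | ⟨ρ, hfin, hlt⟩
  · left
    rintro _ ⟨x, hx, rfl⟩
    exact (htop ⟨x, hx⟩).mp (h ⟨x, hx⟩)
  · right
    refine ⟨ρ, ?_, ?_⟩
    · refine (hfin.image fun x : C => Foliation.leaf p (x : M)).subset ?_
      rintro _ ⟨⟨x, hx, rfl⟩, hne⟩
      exact ⟨⟨x, hx⟩, hne, rfl⟩
    · rintro _ ⟨x, hx, rfl⟩ hne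
      exact hlt ⟨x, hx⟩ hne
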